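/- All algorithms are randomized and adaptive, with access to independent samples from unknown distributions; the number of samples an algorithm uses is the worst case over all sample values and all internal randomness. For distributions on a finite set, $\mathrm{TV}(p,q)=\frac12\sum_x|p(x)-q(x)|$ and $\|p\|_2^2=\sum_x p(x)^2$. A distribution is $\varepsilon$-far from product if its total variation distance to every product distribution is at least $\varepsilon$. *Subroutines.* An $\ell_2^2$-norm estimator $E$ is a family of algorithms such that, for every $N$ and $\delta\in(0,1/2]$, $E(N,\delta)$ uses $O(\sqrt N\log(1/\delta))$ samples from an unknown distribution $p$ on $[N]$ and outputs $L$ with $\frac12\|p\|_2^2\le L\le\frac32\|p\|_2^2$ with probability at least $1-\delta$. A closeness tester $T$ is a family of algorithms such that, for every $N$, $b>0$, $\varepsilon\in(0,1)$, $\delta\in(0,1/2]$, $T(N,b,\varepsilon,\delta)$ uses $O(N\sqrt b\,\varepsilon^{-2}\log(1/\delta))$ samples from two unknown distributions $p,q$ on $[N]$ and, whenever $b\ge\min(\|p\|_2^2,\|q\|_2^2)$, accepts with probability at least $1-\delta$ if $p=q$ and rejects with probability at least $1-\delta$ if $\mathrm{TV}(p,q)\ge\varepsilon$. *Algorithm 1.*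 Input: $n,m$, $\alpha$, $\varepsilon$, a prediction $\hat p$ on $[n]\times[m]$ with marginals $\hat p_1,\hat p_2$, and sample access to $p$ on $[n]\times[m]$ with marginals $p_1,p_2$. Let $s_1=\min(n^{2/3}m^{1/3}\alpha^{1/3}\varepsilon^{-4/3},\,n\alpha)$, $s_2=m\alpha$, $\tau_1=\frac{2\alpha}{s_1}+\frac4n$, $\tau_2=\frac{2\alpha}{s_2}+\frac4m$ (with $0/0=0$ when $\alpha=0$), $c=120$, $c'=160$. 1. Draw $\hat s_1\sim\mathrm{Poi}(s_1)$ and $\hat s_2\sim\mathrm{Poi}(s_2)$. If $\hat s_1>c's_1$ or $\hat s_2>c's_2$, output *reject*. 2. Draw $\hat s_1$ samples from $p_1$ and $\hat s_2$ samples from $p_2$, and let $N^{(1)}_i$, $N^{(2)}_j$ be the frequencies of $i\in[n]$ and $j\in[m]$. Put $b^{(1)}_i=\lfloor n\hat p_1(i)\rfloor+N^{(1)}_i+1$ and $b^{(2)}_j=\lfloor m\hat p_2(j)\rfloor+N^{(2)}_j+1$, $B_1=\sum_i b^{(1)}_i$, $B_2=\sum_j b^{(2)}_j$. Let $p_1^{(F_1)}$,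 $p_2^{(F_2)}$, $p^{(F)}$ be the distributions obtained by sending $i$ to $(i,k)$, $j$ to $(j,\ell)$, and $(i,j)$ to $(i,j,k,\ell)$, with $k\in[b^{(1)}_i]$ and $\ell\in[b^{(2)}_j]$ uniform and independent. 3. With fresh samples, obtain estimates $L_1$ of $\|p_1^{(F_1)}\|_2^2$ from $E(B_1,1/120)$ and $L_2$ of $\|p_2^{(F_2)}\|_2^2$ from $E(B_2,1/120)$. If $L_1>c\tau_1$ or $L_2>c\tau_2$, output *inaccurate information*. 4. With fresh samples, obtain an estimate $L$ of $\|p^{(F)}\|_2^2$ from $E(B_1B_2,1/120)$. If $L>10c^2\tau_1\tau_2$, output *reject*. 5. With fresh samples, run $T(B_1B_2,\,4c^2\tau_1\tau_2,\,\varepsilon,\,1/80)$ on $p^{(F)}$ and $p_1^{(F_1)}\times p_2^{(F_2)}$ and output its answer (*accept* or *reject*). *Augmented testers.* An algorithm that is given a prediction $\hat p$ and samples from $p$, and outputs *accept*, *reject* or *inaccurate information*, is an $(\alpha,\varepsilon,\delta)$-augmented independence tester on $[n]\times[m]$ if for all distributions $p,\hat p$ on $[n]\times[m]$: (i) if $p$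 is a product distribution, it outputs *reject* with probability at most $\delta/2$; (ii) if $p$ is $\varepsilon$-far from product, it outputs *accept* with probability at most $\delta/2$; (iii) if $\mathrm{TV}(p,\hat p)\le\alpha$, it outputs *inaccurate information* with probability at most $\delta/2$. **Theorem.** $\ell_2^2$-norm estimators and closeness testers as above exist, and for every choice of such $E$ and $T$ there is a constant $C>0$ such that for all integers $n\ge m\ge2$, all $\varepsilon\in(0,1)$ and all $\alpha\in[0,1]$, Algorithm 1 is an $(\alpha,\varepsilon,0.1)$-augmented independence tester on $[n]\times[m]$ that, for every prediction $\hat p$, uses at most $$C\cdot\max\left\{\frac{\sqrt{nm}}{\varepsilon^2},\ \frac{n^{2/3}m^{1/3}\alpha^{1/3}}{\varepsilon^{4/3}}\right\}$$ samples. -/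

import Mathlib

noncomputable section

/-! ### Randomized algorithms with sample access -/

/-- A randomized, adaptive algorithm with output in `R` that has sample access to a family, indexed
by `ι`, of unknown distributions on `X`. It may output a value, draw a fresh independent sample from
the `i`-th unknown distribution, or use internal randomness from a known distribution. -/
inductive SampleProg (ι X R : Type) : Type 1
  | ret (r : R) : SampleProg ι X R
  | draw (i : ι) (k : X → SampleProg ι X R) : SampleProg ι X R
  | toss {A : Type} (q : PMF A) (k : A → SampleProg ι X R) : SampleProg ι X R

namespace SampleProg

variable {ι κ X Y R S : Type}

/-- Run the first algorithm and feed its output to the second one. -/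
def bind : SampleProg ι X R → (R → SampleProg ι X S) → SampleProg ι X S
  | ret r, f => f r
  | draw i k, f => draw i fun x => (k x).bind f
  | toss q k, f => toss q fun a => (k a).bind f

instance : Monad (SampleProg ι X) where
  pure := ret
  bind := bind

/-- The law of the output when the unknown distributions are `p i`. -/
def run (p : ι → PMF X) : SampleProg ι X R → PMF R
  | ret r => PMF.pure r
  | draw i k => (p i).bind fun x => (k x).run p
  | toss q k => q.bind fun a => (k a).run p

/-- The worst-case number of samples drawn, over all values of the samples and all possible values
of the internal randomness. -/
def maxSamples : SampleProg ι X R → ℕ∞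
  | ret _ => 0
  | draw _ k => (⨆ x, (k x).maxSamples) + 1
  | toss q k => ⨆ a ∈ q.support, (k a).maxSamples

/-- The algorithm never draws more than `B` samples. -/
def UsesAtMost (P : SampleProg ι X R) (B : ℝ) : Prop :=
  ∃ k : ℕ, P.maxSamples ≤ k ∧ (k : ℝ) ≤ B

/-- One sample from the `i`-th unknown distribution. -/
def sample (i : ι) : SampleProg ι X X := draw i ret

/-- `k` independent samples from the `i`-th unknown distribution. -/
def samples (i : ι) : ℕ → SampleProg ι X (List X)
  | 0 => ret []
  | k + 1 => do
    let x ← sample i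
    let xs ← samples i k
    return x :: xs

/-- One draw from the known distribution `q`. -/
def random (q : PMF R) : SampleProg ι X R := toss q ret

/-- Run an algorithm on distributions on `Y`, where `h i` is the procedure that generates one sample
of the `i`-th of them. -/
def simulate (h : κ → SampleProg ι X Y) : SampleProg κ Y R → SampleProg ι X R
  | ret r => ret r
  | draw i k => (h i).bind fun y => simulate h (k y)
  | toss q k => toss q fun a => simulate h (k a)

end SampleProg

open SampleProg

/-! ### Discrete distributions -/

/-- Total variation distance of two distributions on a finite set. -/
def tvDist {X : Type} [Fintype X] (p q : PMF X) : ℝ :=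
  (1 / 2) * ∑ x, |(p x).toReal - (q x).toReal|

/-- The squared `ℓ₂`-norm of a distribution on a finite set. -/
def l2NormSq {X : Type} [Fintype X] (p : PMF X) : ℝ :=
  ∑ x, (p x).toReal ^ 2

/-- Product distributions on `[n] × [m]`. -/
def IsProductDist {n m : ℕ} (p : PMF (Fin n × Fin m)) : Prop :=
  ∃ (q : PMF (Fin n)) (r : PMF (Fin m)), ∀ i j, p (i, j) = q i * r j

/-- `p` is `ε`-far from every product distribution. -/
def IsFarFromProduct {n m : ℕ} (ε : ℝ) (p : PMF (Fin n × Fin m)) : Prop :=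
  ∀ q : PMF (Fin n × Fin m), IsProductDist q → ε ≤ tvDist p q

/-! ### The two subroutines -/

/-- `E N δ` estimates the squared `ℓ₂`-norm of an unknown distribution on `[N]` within a factor
`1 ± 1/2`, with failure probability at most `δ`, from `O(√N log (1/δ))` samples. -/
def IsL2NormEstimator (E : (N : ℕ) → (δ : ℝ) → SampleProg Unit (Fin N) ℝ) : Prop :=
  ∃ C : ℝ, 0 < C ∧ ∀ (N : ℕ) (δ : ℝ), 0 < δ → δ ≤ 1 / 2 →
    (E N δ).UsesAtMost (C * (√N * Real.log (1 / δ))) ∧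
    ∀ p : PMF (Fin N),
      1 - δ ≤ (((E N δ).run fun _ => p).toOuterMeasure
        {L | l2NormSq p / 2 ≤ L ∧ L ≤ 3 * l2NormSq p / 2}).toReal

/-- `T N b ε δ` has sample access to two unknown distributions `p` (index `false`) and `q` (index
`true`) on `[N]`. If `b ≥ min (‖p‖₂²) (‖q‖₂²)`, it distinguishes `p = q` (output `true`) from
`TV(p, q) ≥ ε` (output `false`) with failure probability at most `δ`; it uses
`O(N √b / ε² · log (1/δ))` samples. -/
def IsClosenessTester (T : (N : ℕ) → (b ε δ : ℝ) → SampleProg Bool (Fin N) Bool) : Prop :=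
  ∃ C : ℝ, 0 < C ∧ ∀ (N : ℕ) (b ε δ : ℝ), 0 < b → 0 < ε → ε < 1 → 0 < δ → δ ≤ 1 / 2 →
    (T N b ε δ).UsesAtMost (C * (N * √b / ε ^ 2 * Real.log (1 / δ))) ∧
    ∀ p q : PMF (Fin N), min (l2NormSq p) (l2NormSq q) ≤ b →
      (p = q → 1 - δ ≤ (((T N b ε δ).run fun i => bif i then q else p) true).toReal) ∧
      (ε ≤ tvDist p q → 1 - δ ≤ (((T N b ε δ).run fun i => bif i then q else p) false).toReal)

/-! ### Augmented flattening -/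

/-- The number of buckets `⌊n q(i)⌋ + N_i + 1` of each `i ∈ [n]`, where `q` is the prediction and
`N_i` is the frequency of `i` among the samples. -/
def buckets {n : ℕ} (q : PMF (Fin n)) (samp : List (Fin n)) (i : Fin n) : ℕ :=
  ⌊(n : ℝ) * (q i).toReal⌋₊ + samp.count i + 1

instance {n : ℕ} (q : PMF (Fin n)) (samp : List (Fin n)) (i : Fin n) :
    NeZero (buckets q samp i) :=
  ⟨Nat.succ_ne_zero _⟩

/-- Send `i ∈ [n]` to a uniformly random one of its `b i` buckets. The flattened domain, the
disjoint union of the sets of buckets, is identified with `[∑ i, b i]`. -/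
def flattenPoint {ι X : Type} {n : ℕ} (b : Fin n → ℕ) [∀ i, NeZero (b i)] (i : Fin n) :
    SampleProg ι X (Fin (∑ i, b i)) := do
  let k ← random (PMF.uniformOfFintype (Fin (b i)))
  return finSigmaFinEquiv ⟨i, k⟩

section FlatSamples

variable {n m : ℕ} (b₁ : Fin n → ℕ) (b₂ : Fin m → ℕ) [∀ i, NeZero (b₁ i)] [∀ j, NeZero (b₂ j)]

/-- A sample from the flattened first marginal. -/
def flatSample₁ : SampleProg Unit (Fin n × Fin m) (Fin (∑ i, b₁ i)) := do
  let x ← sample ()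
  flattenPoint b₁ x.1

/-- A sample from the flattened second marginal. -/
def flatSample₂ : SampleProg Unit (Fin n × Fin m) (Fin (∑ j, b₂ j)) := do
  let x ← sample ()
  flattenPoint b₂ x.2

/-- A sample from the flattened joint distribution. -/
def flatSampleJoint :
    SampleProg Unit (Fin n × Fin m) (Fin ((∑ i, b₁ i) * ∑ j, b₂ j)) := do
  let x ← sample ()
  let u ← flattenPoint b₁ x.1
  let v ← flattenPoint b₂ x.2
  return finProdFinEquiv (u, v)

/-- A sample from the product of the flattened marginals. -/
def flatSampleProd :
    SampleProg Unit (Fin n × Fin m) (Fin ((∑ i, b₁ i) * ∑ j, b₂ j)) := do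
  let u ← flatSample₁ b₁
  let v ← flatSample₂ b₂
  return finProdFinEquiv (u, v)

end FlatSamples

/-! ### The augmented independence tester -/

/-- The three possible outputs. -/
inductive Verdict
  | accept
  | reject
  | inaccurate

/-- The part of the tester that follows the construction of the flattening, with `c = 120`. -/
def flattenedTest (E : (N : ℕ) → (δ : ℝ) → SampleProg Unit (Fin N) ℝ)
    (T : (N : ℕ) → (b ε δ : ℝ) → SampleProg Bool (Fin N) Bool)
    {n m : ℕ} (b₁ : Fin n → ℕ) (b₂ : Fin m → ℕ) [∀ i, NeZero (b₁ i)] [∀ j, NeZero (b₂ j)]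
    (τ₁ τ₂ ε : ℝ) : SampleProg Unit (Fin n × Fin m) Verdict := do
  let L₁ ← simulate (fun _ => flatSample₁ b₁) (E (∑ i, b₁ i) (1 / 120))
  let L₂ ← simulate (fun _ => flatSample₂ b₂) (E (∑ j, b₂ j) (1 / 120))
  if L₁ > 120 * τ₁ ∨ L₂ > 120 * τ₂ then
    return Verdict.inaccurate
  else
    let L ← simulate (fun _ => flatSampleJoint b₁ b₂) (E ((∑ i, b₁ i) * ∑ j, b₂ j) (1 / 120))
    if L > 10 * 120 ^ 2 * τ₁ * τ₂ then
      return Verdict.reject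
    else
      let closeEnough ← simulate
        (fun i => bif i then flatSampleProd b₁ b₂ else flatSampleJoint b₁ b₂)
        (T ((∑ i, b₁ i) * ∑ j, b₂ j) (4 * 120 ^ 2 * τ₁ * τ₂) ε (1 / 80))
      return (bif closeEnough then Verdict.accept else Verdict.reject)

/-- The Poisson distribution with mean `s ≥ 0`. -/
def poisson (s : ℝ) : PMF ℕ :=
  (ProbabilityTheory.poissonMeasure s.toNNReal).toPMF

/-- The augmented independence tester on `[n] × [m]` with prediction `phat`, suggested prediction
error `α` and proximity parameter `ε`, built from the norm estimator `E` and the closeness tester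
`T`; the constants are `c = 120` and `c' = 160`. For `α = 0` one has `s₁ = s₂ = 0`, and the terms
`2 * α / s₁` and `2 * α / s₂` are `0`. -/
def augIndependenceTester (E : (N : ℕ) → (δ : ℝ) → SampleProg Unit (Fin N) ℝ)
    (T : (N : ℕ) → (b ε δ : ℝ) → SampleProg Bool (Fin N) Bool)
    (n m : ℕ) (α ε : ℝ) (phat : PMF (Fin n × Fin m)) :
    SampleProg Unit (Fin n × Fin m) Verdict := do
  let s₁ : ℝ := min ((n : ℝ) ^ (2 / 3 : ℝ) * (m : ℝ) ^ (1 / 3 : ℝ) * α ^ (1 / 3 : ℝ)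
    * ε ^ (-4 / 3 : ℝ)) (n * α)
  let s₂ : ℝ := m * α
  let t₁ ← random (poisson s₁)
  let t₂ ← random (poisson s₂)
  if (t₁ : ℝ) > 160 * s₁ ∨ (t₂ : ℝ) > 160 * s₂ then
    return Verdict.reject
  else
    let S₁ ← samples () t₁
    let S₂ ← samples () t₂
    flattenedTest E T (buckets (phat.map Prod.fst) (S₁.map Prod.fst))
      (buckets (phat.map Prod.snd) (S₂.map Prod.snd))
      (2 * α / s₁ + 4 / n) (2 * α / s₂ + 4 / m) ε

/-- `A` is an `(α, ε, δ)`-augmented independence tester on `[n] × [m]`: for every unknown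
distribution `p` and every prediction `phat`, each of the three errors has probability at most
`δ / 2`. -/
def IsAugIndependenceTester {n m : ℕ} (α ε δ : ℝ)
    (A : (phat : PMF (Fin n × Fin m)) → SampleProg Unit (Fin n × Fin m) Verdict) : Prop :=
  ∀ p phat : PMF (Fin n × Fin m),
    (IsProductDist p → (((A phat).run fun _ => p) Verdict.reject).toReal ≤ δ / 2) ∧
    (IsFarFromProduct ε p → (((A phat).run fun _ => p) Verdict.accept).toReal ≤ δ / 2) ∧
    (tvDist p phat ≤ α → (((A phat).run fun _ => p) Verdict.inaccurate).toReal ≤ δ / 2)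

end

/-! Splitting each point `i` into `b i` equally likely buckets preserves products
(`flattenLaw₂_prodLaw`) and total variation distance (`tvDist_flattenLaw₂`), and turns the squared
norm into `∑ p i ^ 2 / b i`. Independence testing thus becomes closeness testing between the
flattened joint law and the product of the flattened marginals, and a small norm of that product
makes this cheap.

Both the prediction `q` and the samples supply buckets (`lexp_sq_div_buckets_le`). Where `p i ≤ 2 *
q i`, the `⌊n * q i⌋ + 1` predicted buckets bound the contribution of `i` by `2 * p i / n`.
Elsewhere the excess `p i - q i` is at least `p i / 2`, and a size-bias identity bounds the
expectation of `1 / (N_i + 1)` by `1 / (s * p i)`, so `i` contributes at most `2 * (p i - q i) / s`.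
Since the positive parts of `p i - q i` add up to the total variation distance, an `α`-accurate
prediction gives expected norm at most `2 * α / s + 4 / n`. Markov's inequality then controls the
verdict "inaccurate information" (`prob_flattenedTest_inaccurate_le`).

The other two verdicts need no accuracy of the prediction. If a marginal norm is too large, a
correct estimate already yields "inaccurate information"; otherwise the product meets the norm
promise of the closeness tester, which constrains only the smaller of the two norms
(`prob_flattenedTest_le`).

For the cost, put `A = n^(2/3) m^(1/3) α^(1/3) / ε^(4/3)`, so that `A ^ 3 * ε ^ 4 = n ^ 2 * m * α`.
The rate `s₁ = min A (n * α)` balances the samples spent on flattening against the cost of the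
closeness test (`closenessCost_le`).

Both subroutines exist by one second-moment computation: a symmetric kernel summed over two
independent groups of `k` samples has an explicit variance (`rexpList_bilinearSum_sq`). The equality
kernel estimates the squared norm, and `closenessKernel` the squared distance. Chebyshev's
inequality gives failure probability `1/16`, and a median or majority over independent runs reduces
it to `δ`. -/

open scoped ENNReal

noncomputable section

/-! ### Expectations and probabilities under a `PMF` -/

namespace PMF

variable {Ω Ω₂ : Type}

/-- The expectation of an extended nonnegative function. -/
def lexp (μ : PMF Ω) (f : Ω → ℝ≥0∞) : ℝ≥0∞ := ∑' x, μ x * f x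

theorem lexp_pure (a : Ω) (f : Ω → ℝ≥0∞) : (PMF.pure a).lexp f = f a := by
  unfold lexp
  rw [tsum_eq_single a]
  · simp
  · intro b hb
    simp [PMF.pure_apply, hb]

theorem lexp_bind (μ : PMF Ω) (g : Ω → PMF Ω₂) (f : Ω₂ → ℝ≥0∞) :
    (μ.bind g).lexp f = μ.lexp fun x => (g x).lexp f := by
  simp only [lexp, PMF.bind_apply, ← ENNReal.tsum_mul_right, ← ENNReal.tsum_mul_left]
  rw [ENNReal.tsum_comm]
  simp only [mul_assoc]

theorem lexp_mono (μ : PMF Ω) {f g : Ω → ℝ≥0∞} (h : ∀ x, f x ≤ g x) : μ.lexp f ≤ μ.lexp g :=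
  ENNReal.tsum_le_tsum fun x => by gcongr; exact h x

theorem lexp_const (μ : PMF Ω) (c : ℝ≥0∞) : (μ.lexp fun _ => c) = c := by
  simp [lexp, ENNReal.tsum_mul_right, μ.tsum_coe]

theorem lexp_add (μ : PMF Ω) (f g : Ω → ℝ≥0∞) :
    (μ.lexp fun x => f x + g x) = μ.lexp f + μ.lexp g := by
  simp [lexp, mul_add, ENNReal.tsum_add]

theorem lexp_const_mul (μ : PMF Ω) (c : ℝ≥0∞) (f : Ω → ℝ≥0∞) :
    (μ.lexp fun x => c * f x) = c * μ.lexp f := by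
  simp only [lexp, ← ENNReal.tsum_mul_left]
  exact tsum_congr fun x => by ring

theorem lexp_mul_const (μ : PMF Ω) (c : ℝ≥0∞) (f : Ω → ℝ≥0∞) :
    (μ.lexp fun x => f x * c) = μ.lexp f * c := by
  simp only [mul_comm _ c, lexp_const_mul]

theorem lexp_finset_sum {ι : Type} (μ : PMF Ω) (s : Finset ι) (f : ι → Ω → ℝ≥0∞) :
    (μ.lexp fun x => ∑ i ∈ s, f i x) = ∑ i ∈ s, μ.lexp (f i) := by
  simp only [lexp, Finset.mul_sum]
  exact Summable.tsum_finsetSum fun _ _ => ENNReal.summable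

theorem lexp_le_of_le (μ : PMF Ω) {f : Ω → ℝ≥0∞} {c : ℝ≥0∞} (h : ∀ x, f x ≤ c) : μ.lexp f ≤ c :=
  (μ.lexp_mono h).trans (μ.lexp_const c).le

/-- The probability of an event. -/
def prob (μ : PMF Ω) (S : Set Ω) : ℝ≥0∞ := μ.toOuterMeasure S

theorem prob_eq_lexp (μ : PMF Ω) (S : Set Ω) : μ.prob S = μ.lexp (S.indicator 1) := by
  unfold prob lexp
  rw [PMF.toOuterMeasure_apply]
  refine tsum_congr fun x => ?_
  by_cases h : x ∈ S <;> simp [h]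

theorem prob_bind (μ : PMF Ω) (g : Ω → PMF Ω₂) (S : Set Ω₂) :
    (μ.bind g).prob S = μ.lexp fun x => (g x).prob S := by
  simp only [prob_eq_lexp, lexp_bind]

open Classical in
theorem prob_pure (a : Ω) (S : Set Ω) : (PMF.pure a).prob S = if a ∈ S then 1 else 0 := by
  rw [prob_eq_lexp, lexp_pure]
  by_cases h : a ∈ S <;> simp [h]

theorem prob_singleton (μ : PMF Ω) (a : Ω) : μ.prob {a} = μ a :=
  μ.toOuterMeasure_apply_singleton a

theorem prob_le_one (μ : PMF Ω) (S : Set Ω) : μ.prob S ≤ 1 := by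
  rw [prob_eq_lexp]
  exact μ.lexp_le_of_le fun x => Set.indicator_le_self' (fun _ _ => zero_le) x

theorem prob_ne_top (μ : PMF Ω) (S : Set Ω) : μ.prob S ≠ ∞ :=
  ne_top_of_le_ne_top ENNReal.one_ne_top (μ.prob_le_one S)

theorem prob_add_prob_compl (μ : PMF Ω) (S : Set Ω) : μ.prob S + μ.prob Sᶜ = 1 := by
  rw [prob_eq_lexp, prob_eq_lexp, ← lexp_add]
  convert μ.lexp_const 1 using 2
  ext x
  by_cases h : x ∈ S <;> simp [h]

theorem one_sub_le_prob_of_prob_compl_le {μ : PMF Ω} {S : Set Ω} {δ : ℝ} (hδ : 0 ≤ δ)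
    (h : μ.prob Sᶜ ≤ ENNReal.ofReal δ) : 1 - δ ≤ (μ.toOuterMeasure S).toReal := by
  have h1 := congrArg ENNReal.toReal (μ.prob_add_prob_compl S)
  rw [ENNReal.toReal_add (μ.prob_ne_top _) (μ.prob_ne_top _), ENNReal.toReal_one] at h1
  have h2 := ENNReal.toReal_le_of_le_ofReal hδ h
  change 1 - δ ≤ (μ.prob S).toReal
  linarith

theorem prob_compl_le_of_one_sub_le {μ : PMF Ω} {S : Set Ω} {δ : ℝ}
    (h : 1 - δ ≤ (μ.toOuterMeasure S).toReal) : μ.prob Sᶜ ≤ ENNReal.ofReal δ := by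
  have h1 := congrArg ENNReal.toReal (μ.prob_add_prob_compl S)
  rw [ENNReal.toReal_add (μ.prob_ne_top _) (μ.prob_ne_top _), ENNReal.toReal_one] at h1
  change 1 - δ ≤ (μ.prob S).toReal at h
  rw [← ENNReal.ofReal_toReal (μ.prob_ne_top Sᶜ)]
  exact ENNReal.ofReal_le_ofReal (by linarith)

/-- Markov's inequality. -/
theorem prob_mul_le_lexp (μ : PMF Ω) {S : Set Ω} {f : Ω → ℝ≥0∞} {c : ℝ≥0∞}
    (h : ∀ x ∈ S, c ≤ f x) : c * μ.prob S ≤ μ.lexp f := by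
  rw [prob_eq_lexp, ← lexp_const_mul]
  refine μ.lexp_mono fun x => ?_
  by_cases hx : x ∈ S
  · simpa [hx] using h x hx
  · simp [hx]

/-- A bound for two-stage experiments: outside the exceptional event `S` of the first stage, the
event `U` of the second stage has probability at most `c`. -/
theorem prob_bind_le (μ : PMF Ω) (g : Ω → PMF Ω₂) (S : Set Ω) (U : Set Ω₂) (c : ℝ≥0∞)
    (h : ∀ x ∉ S, (g x).prob U ≤ c) : (μ.bind g).prob U ≤ μ.prob S + c := by
  rw [prob_bind, prob_eq_lexp μ S, ← μ.lexp_const c, ← lexp_add]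
  refine μ.lexp_mono fun x => ?_
  by_cases hx : x ∈ S
  · simpa [hx] using ((g x).prob_le_one U).trans le_self_add
  · simpa [hx, lexp_const] using h x hx

theorem toReal_sum_eq_one [Fintype Ω] (μ : PMF Ω) : ∑ x, (μ x).toReal = 1 := by
  rw [← ENNReal.toReal_sum fun x _ => μ.apply_ne_top x, ← tsum_fintype (L := .unconditional _),
    μ.tsum_coe, ENNReal.toReal_one]

/-- The law of a list of `k` independent samples. -/
def iidList (μ : PMF Ω) : ℕ → PMF (List Ω)
  | 0 => PMF.pure []
  | k + 1 => μ.bind fun x => (iidList μ k).bind fun l => PMF.pure (x :: l)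

theorem lexp_iidList_zero (μ : PMF Ω) (f : List Ω → ℝ≥0∞) : (μ.iidList 0).lexp f = f [] :=
  lexp_pure _ _

theorem lexp_iidList_succ (μ : PMF Ω) (k : ℕ) (f : List Ω → ℝ≥0∞) :
    (μ.iidList (k + 1)).lexp f = μ.lexp fun x => (μ.iidList k).lexp fun l => f (x :: l) := by
  simp only [iidList, lexp_bind, lexp_pure]

theorem support_iidList_length (μ : PMF Ω) (k : ℕ) : ∀ l ∈ (μ.iidList k).support, l.length = k := by
  induction k with
  | zero => simp [iidList]
  | succ k ih =>
    intro l hl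
    simp only [iidList, PMF.mem_support_bind_iff, PMF.mem_support_pure_iff] at hl
    obtain ⟨x, _, l', hl', rfl⟩ := hl
    simp [ih l' hl']

theorem prob_mono_support (μ : PMF Ω) {S S' : Set Ω} (h : ∀ x ∈ μ.support, x ∈ S → x ∈ S') :
    μ.prob S ≤ μ.prob S' :=
  μ.toOuterMeasure_mono fun x hx => h x hx.2 hx.1

/-! ### Amplification -/

-- The exponential moment factors over the draws, and `16 ^ 1_S ≤ 1 + 16 * 1_S`. The sharper
-- coefficient 15 is not needed.
open Classical in
theorem lexp_pow_countP (μ : PMF Ω) (S : Set Ω) (k : ℕ) :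
    ((μ.iidList k).lexp fun l => 16 ^ l.countP (fun x => decide (x ∈ S)))
      ≤ (1 + 16 * μ.prob S) ^ k := by
  induction k with
  | zero => simp [lexp_iidList_zero]
  | succ k ih =>
    rw [lexp_iidList_succ]
    calc (μ.lexp fun x => (μ.iidList k).lexp fun l => 16 ^ (x :: l).countP (fun x => decide (x ∈ S)))
        ≤ μ.lexp fun x => (1 + 16 * S.indicator 1 x) * (1 + 16 * μ.prob S) ^ k := by
          refine μ.lexp_mono fun x => ?_
          by_cases hx : x ∈ S
          · have : ∀ l : List Ω, (16 : ℝ≥0∞) ^ (x :: l).countP (fun x => decide (x ∈ S))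
                = 16 * 16 ^ l.countP (fun x => decide (x ∈ S)) := fun l => by
              simp [hx, pow_succ, mul_comm]
            simp only [this, lexp_const_mul]
            gcongr
            simp [hx]
          · simpa [hx] using ih
      _ = (1 + 16 * μ.prob S) ^ (k + 1) := by
          rw [lexp_mul_const, lexp_add, lexp_const, lexp_const_mul, ← prob_eq_lexp, pow_succ,
            mul_comm]

open Classical in
/-- If an event has probability at most `1/16`, then among `k` independent trials it happens at
least `k/2` times with probability at most `2⁻ᵏ`. -/
theorem prob_majority_le (μ : PMF Ω) (S : Set Ω) (hS : μ.prob S ≤ ENNReal.ofReal (1 / 16)) (k : ℕ) :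
    (μ.iidList k).prob {l | k ≤ 2 * l.countP (fun x => decide (x ∈ S))}
      ≤ ENNReal.ofReal ((1 / 2) ^ k) := by
  -- Markov for `16 ^ count`: on the event this is at least `16 ^ (k/2) = 4 ^ k`, while its mean is
  -- at most `(1 + 16/16) ^ k = 2 ^ k`.
  have h1 : (4 : ℝ≥0∞) ^ k * (μ.iidList k).prob {l | k ≤ 2 * l.countP (fun x => decide (x ∈ S))}
      ≤ 2 ^ k := by
    refine ((μ.iidList k).prob_mul_le_lexp (f := fun l => 16 ^ l.countP (fun x => decide (x ∈ S)))
      fun l hl => ?_).trans ((μ.lexp_pow_countP S k).trans ?_)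
    · rw [show (16 : ℝ≥0∞) = 4 ^ 2 by norm_num, ← pow_mul]
      exact pow_le_pow_right₀ (by norm_num) hl
    · gcongr
      calc 1 + 16 * μ.prob S ≤ 1 + 16 * ENNReal.ofReal (1 / 16) := by gcongr
        _ = 2 := by
          rw [← ENNReal.ofReal_ofNat 16, ← ENNReal.ofReal_mul (by norm_num), ← ENNReal.ofReal_one,
            ← ENNReal.ofReal_add (by norm_num) (by norm_num)]
          norm_num
  have hne := (μ.iidList k).prob_ne_top {l | k ≤ 2 * l.countP (fun x => decide (x ∈ S))}
  rw [← ENNReal.ofReal_toReal hne]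
  refine ENNReal.ofReal_le_ofReal ?_
  have h2 := ENNReal.toReal_mono (by simp) h1
  simp only [ENNReal.toReal_mul, ENNReal.toReal_pow, ENNReal.toReal_ofNat] at h2
  rw [one_div, inv_pow, ← one_div, le_div_iff₀ (by positivity)]
  have h4 : (4 : ℝ) ^ k = 2 ^ k * 2 ^ k := by rw [← mul_pow]; norm_num
  have hpos : (0 : ℝ) < 2 ^ k := by positivity
  rw [h4] at h2
  nlinarith

end PMF

/-! ### Laws and sample counts of composite programs -/

namespace SampleProg

variable {ι κ X Y R S : Type}

theorem pure_eq_ret (r : R) : (pure r : SampleProg ι X R) = ret r := rfl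

theorem monad_bind_eq_bind (P : SampleProg ι X R) (f : R → SampleProg ι X S) :
    P >>= f = P.bind f := rfl

theorem run_ret (p : ι → PMF X) (r : R) : (ret r : SampleProg ι X R).run p = PMF.pure r := rfl

theorem run_bind (p : ι → PMF X) (P : SampleProg ι X R) (f : R → SampleProg ι X S) :
    (P.bind f).run p = (P.run p).bind fun r => (f r).run p := by
  induction P with
  | ret r => simp [bind, run, PMF.pure_bind]
  | draw i k ih => simp only [bind, run, ih, PMF.bind_bind]
  | toss q k ih => simp only [bind, run, ih, PMF.bind_bind]

theorem run_sample (p : ι → PMF X) (i : ι) : (sample i).run p = p i := by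
  simp [sample, run, PMF.bind_pure]

theorem run_random (p : ι → PMF X) (q : PMF R) : (random q).run p = q := by
  simp [random, run, PMF.bind_pure]

/-- Guarantees of a subroutine that hold for all input distributions apply verbatim to samples
generated by another program. -/
theorem run_simulate (p : ι → PMF X) (h : κ → SampleProg ι X Y) (P : SampleProg κ Y R) :
    (simulate h P).run p = P.run fun i => (h i).run p := by
  induction P with
  | ret r => rfl
  | draw i k ih => simp only [simulate, run, run_bind, ih]
  | toss q k ih => simp only [simulate, run, ih]

theorem run_samples (p : ι → PMF X) (i : ι) (k : ℕ) : (samples i k).run p = (p i).iidList k := by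
  induction k with
  | zero => rfl
  | succ k ih =>
    simp only [samples, monad_bind_eq_bind, pure_eq_ret, run_bind, run_sample, ih, run_ret,
      PMF.iidList]

theorem maxSamples_bind_le (P : SampleProg ι X R) (f : R → SampleProg ι X S) {a b : ℕ∞}
    (hP : P.maxSamples ≤ a) (hf : ∀ r, (f r).maxSamples ≤ b) : (P.bind f).maxSamples ≤ a + b := by
  -- The bound `a` cannot stay fixed in the induction, as each draw consumes part of it; the exact
  -- count of the first stage can.
  suffices h : (P.bind f).maxSamples ≤ P.maxSamples + b from h.trans (by gcongr)
  clear hP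
  induction P with
  | ret r => simpa [bind, maxSamples] using hf r
  | draw i k ih =>
    simp only [bind, maxSamples]
    rw [add_right_comm]
    gcongr
    exact iSup_le fun x => (ih x).trans (by gcongr; exact le_iSup (fun x => (k x).maxSamples) x)
  | toss q k ih =>
    simp only [bind, maxSamples]
    exact iSup₂_le fun a ha => (ih a).trans
      (by gcongr; exact le_iSup₂ (f := fun a (_ : a ∈ q.support) => (k a).maxSamples) a ha)

theorem maxSamples_ret_le (r : R) (a : ℕ∞) : (ret r : SampleProg ι X R).maxSamples ≤ a := zero_le

theorem maxSamples_random_le (q : PMF R) (a : ℕ∞) :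
    (random q : SampleProg ι X R).maxSamples ≤ a :=
  iSup₂_le fun _ _ => zero_le

theorem maxSamples_sample_le (i : ι) : (sample i : SampleProg ι X X).maxSamples ≤ 1 := by
  simp [sample, maxSamples]

theorem maxSamples_simulate_le (h : κ → SampleProg ι X Y) (P : SampleProg κ Y R) {d : ℕ∞}
    (hd : ∀ i, (h i).maxSamples ≤ d) : (simulate h P).maxSamples ≤ d * P.maxSamples := by
  induction P with
  | ret r => exact zero_le
  | draw i k ih =>
    simp only [simulate, maxSamples, mul_add, mul_one]
    rw [add_comm]
    exact maxSamples_bind_le _ _ (hd i) fun y => (ih y).trans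
      (by gcongr; exact le_iSup (fun x => (k x).maxSamples) y)
  | toss q k ih =>
    simp only [simulate, maxSamples]
    exact iSup₂_le fun a ha => (ih a).trans
      (by gcongr; exact le_iSup₂ (f := fun a (_ : a ∈ q.support) => (k a).maxSamples) a ha)

/-- Run an algorithm `k` times and collect the outputs. -/
def repeated (P : SampleProg ι X R) : ℕ → SampleProg ι X (List R)
  | 0 => ret []
  | k + 1 => P.bind fun x => (repeated P k).bind fun l => ret (x :: l)

theorem run_repeated (p : ι → PMF X) (P : SampleProg ι X R) (k : ℕ) :
    (P.repeated k).run p = (P.run p).iidList k := by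
  induction k with
  | zero => rfl
  | succ k ih => simp only [repeated, run_bind, ih, run_ret, PMF.iidList]

theorem maxSamples_repeated_le (P : SampleProg ι X R) {d : ℕ} (hd : P.maxSamples ≤ d) (k : ℕ) :
    (P.repeated k).maxSamples ≤ (k * d : ℕ) := by
  induction k with
  | zero => exact zero_le
  | succ k ih =>
    have h := maxSamples_bind_le P
      (fun x => (P.repeated k).bind fun xs => ret (x :: xs)) (b := ((k * d : ℕ) : ℕ∞) + 0)
      hd fun x => maxSamples_bind_le _ _ ih fun _ => maxSamples_ret_le _ _
    rw [add_zero, add_comm] at h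
    rw [Nat.succ_mul]
    exact_mod_cast h

end SampleProg

end

open scoped ENNReal

noncomputable section

/-! ### Moments of bilinear statistics of independent samples -/

namespace PMF

variable {Ω : Type}

/-- The bilinear statistic `∑ h a b` over the entries `a` of `A` and `b` of `B`. -/
def bilinearSum (h : Ω → Ω → ℝ) (A B : List Ω) : ℝ :=
  (B.map fun b => (A.map fun a => h a b).sum).sum

variable [Fintype Ω]

/-- The expectation of a real function on a finite type. -/
def rexp (μ : PMF Ω) (f : Ω → ℝ) : ℝ := ∑ x, (μ x).toReal * f x

theorem rexp_add (μ : PMF Ω) (f g : Ω → ℝ) :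
    (μ.rexp fun x => f x + g x) = μ.rexp f + μ.rexp g := by
  simp [rexp, mul_add, Finset.sum_add_distrib]

theorem rexp_sub (μ : PMF Ω) (f g : Ω → ℝ) :
    (μ.rexp fun x => f x - g x) = μ.rexp f - μ.rexp g := by
  simp [rexp, mul_sub, Finset.sum_sub_distrib]

theorem rexp_const_mul (μ : PMF Ω) (c : ℝ) (f : Ω → ℝ) :
    (μ.rexp fun x => c * f x) = c * μ.rexp f := by
  simp only [rexp, Finset.mul_sum]
  exact Finset.sum_congr rfl fun x _ => by ring

theorem rexp_const (μ : PMF Ω) (c : ℝ) : (μ.rexp fun _ => c) = c := by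
  simp [rexp, ← Finset.sum_mul, μ.toReal_sum_eq_one]

theorem rexp_mono (μ : PMF Ω) {f g : Ω → ℝ} (h : ∀ x, f x ≤ g x) : μ.rexp f ≤ μ.rexp g :=
  Finset.sum_le_sum fun x _ => mul_le_mul_of_nonneg_left (h x) ENNReal.toReal_nonneg

theorem rexp_nonneg (μ : PMF Ω) {f : Ω → ℝ} (h : ∀ x, 0 ≤ f x) : 0 ≤ μ.rexp f :=
  Finset.sum_nonneg fun x _ => mul_nonneg ENNReal.toReal_nonneg (h x)

theorem lexp_ofReal (μ : PMF Ω) {f : Ω → ℝ} (hf : ∀ x, 0 ≤ f x) :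
    (μ.lexp fun x => ENNReal.ofReal (f x)) = ENNReal.ofReal (μ.rexp f) := by
  unfold lexp rexp
  rw [tsum_fintype, ENNReal.ofReal_sum_of_nonneg fun x _ => mul_nonneg ENNReal.toReal_nonneg (hf x)]
  refine Finset.sum_congr rfl fun x _ => ?_
  rw [ENNReal.ofReal_mul ENNReal.toReal_nonneg, ENNReal.ofReal_toReal (μ.apply_ne_top x)]

/-- The expectation of a real function of a list of `k` independent samples. -/
def rexpList (μ : PMF Ω) : ℕ → (List Ω → ℝ) → ℝ
  | 0, f => f []
  | k + 1, f => μ.rexp fun x => rexpList μ k fun l => f (x :: l)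

theorem rexpList_add (μ : PMF Ω) (k : ℕ) (f g : List Ω → ℝ) :
    (μ.rexpList k fun l => f l + g l) = μ.rexpList k f + μ.rexpList k g := by
  induction k generalizing f g with
  | zero => rfl
  | succ k ih => simp only [rexpList, ih, rexp_add]

theorem rexpList_const_mul (μ : PMF Ω) (k : ℕ) (c : ℝ) (f : List Ω → ℝ) :
    (μ.rexpList k fun l => c * f l) = c * μ.rexpList k f := by
  induction k generalizing f with
  | zero => rfl
  | succ k ih => simp only [rexpList, ih, rexp_const_mul]

theorem rexpList_const (μ : PMF Ω) (k : ℕ) (c : ℝ) : (μ.rexpList k fun _ => c) = c := by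
  induction k with
  | zero => rfl
  | succ k ih => simp only [rexpList, ih, rexp_const]

theorem rexpList_nonneg (μ : PMF Ω) (k : ℕ) {f : List Ω → ℝ} (h : ∀ l, 0 ≤ f l) :
    0 ≤ μ.rexpList k f := by
  induction k generalizing f with
  | zero => exact h _
  | succ k ih => exact μ.rexp_nonneg fun x => ih fun l => h _

theorem rexpList_finset_sum {ι : Type} (μ : PMF Ω) (k : ℕ) (s : Finset ι) (f : ι → List Ω → ℝ) :
    (μ.rexpList k fun l => ∑ i ∈ s, f i l) = ∑ i ∈ s, μ.rexpList k (f i) := by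
  classical
  induction s using Finset.induction_on with
  | empty => simp [rexpList_const]
  | insert i s hi ih => simp only [Finset.sum_insert hi, rexpList_add, ih]

theorem rexpList_rexp (μ ν : PMF Ω) (k : ℕ) (f : List Ω → Ω → ℝ) :
    (μ.rexpList k fun l => ν.rexp (f l)) = ν.rexp fun x => μ.rexpList k fun l => f l x := by
  simp only [rexp, rexpList_finset_sum, rexpList_const_mul]

/-- Moments are computed with finite real sums, where subtraction is available. This carries the
result back to the law on lists, as Markov's inequality requires. -/
theorem lexp_iidList_ofReal (μ : PMF Ω) (k : ℕ) {f : List Ω → ℝ} (hf : ∀ l, 0 ≤ f l) :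
    ((μ.iidList k).lexp fun l => ENNReal.ofReal (f l)) = ENNReal.ofReal (μ.rexpList k f) := by
  induction k generalizing f with
  | zero => rw [lexp_iidList_zero, rexpList]
  | succ k ih =>
    rw [lexp_iidList_succ, rexpList, ← lexp_ofReal _ fun x => μ.rexpList_nonneg k fun l => hf _]
    simp only [ih fun l => hf _]

theorem rexp_list_sum (μ : PMF Ω) (h : Ω → Ω → ℝ) (A : List Ω) :
    (μ.rexp fun b => (A.map fun a => h a b).sum) = (A.map fun a => μ.rexp (h a)).sum := by
  induction A with
  | nil => simp [rexp_const]
  | cons a A ih => simp only [List.map_cons, List.sum_cons, rexp_add, ih]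

theorem rexpList_sum (μ : PMF Ω) (k : ℕ) (g : Ω → ℝ) :
    (μ.rexpList k fun l => (l.map g).sum) = k * μ.rexp g := by
  induction k with
  | zero => simp [rexpList]
  | succ k ih =>
    simp only [rexpList, List.map_cons, List.sum_cons, rexpList_add, rexpList_const, ih, rexp_add,
      rexp_const]
    push_cast; ring

theorem rexpList_sum_sq (μ : PMF Ω) (k : ℕ) (g : Ω → ℝ) :
    (μ.rexpList k fun l => (l.map g).sum ^ 2)
      = k * (μ.rexp fun x => g x ^ 2) + k * (k - 1) * μ.rexp g ^ 2 := by
  induction k with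
  | zero => simp [rexpList]
  | succ k ih =>
    have h : ∀ (x : Ω) (l : List Ω), ((x :: l).map g).sum ^ 2
        = g x ^ 2 + (2 * g x * (l.map g).sum + (l.map g).sum ^ 2) := fun x l => by
      simp only [List.map_cons, List.sum_cons]; ring
    have h' : ∀ x, 2 * g x * (k * μ.rexp g) = (2 * (k * μ.rexp g)) * g x := fun x => by ring
    simp only [rexpList, h, rexpList_add, rexpList_const, rexpList_const_mul, rexpList_sum, ih,
      rexp_add, rexp_const, h', rexp_const_mul]
    push_cast; ring

theorem rexpList_bilinearSum (μ : PMF Ω) (h : Ω → Ω → ℝ) (k : ℕ) :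
    (μ.rexpList k fun A => μ.rexpList k fun B => bilinearSum h A B)
      = k ^ 2 * μ.rexp fun a => μ.rexp (h a) := by
  simp only [bilinearSum, rexpList_sum, rexpList_const_mul, rexp_list_sum]
  ring

/-- Expand the square over two index pairs. The pairs coincide in `k ^ 2` cases, share exactly one
index in `2 * k ^ 2 * (k - 1)` cases (symmetry of `h` merges the two kinds), and are disjoint, hence
independent, in `k ^ 2 * (k - 1) ^ 2` cases. The two groups are separate, so no sample is paired
with itself. -/
theorem rexpList_bilinearSum_sq (μ : PMF Ω) {h : Ω → Ω → ℝ} (hs : ∀ a b, h a b = h b a) (k : ℕ) :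
    (μ.rexpList k fun A => μ.rexpList k fun B => bilinearSum h A B ^ 2)
      = k ^ 2 * (μ.rexp fun a => μ.rexp fun b => h a b ^ 2)
        + 2 * k ^ 2 * (k - 1) * (μ.rexp fun a => μ.rexp (h a) ^ 2)
        + k ^ 2 * (k - 1) ^ 2 * (μ.rexp fun a => μ.rexp (h a)) ^ 2 := by
  have h1 : ∀ b, (μ.rexpList k fun A => (A.map fun a => h a b).sum ^ 2)
      = k * (μ.rexp fun a => h b a ^ 2) + k * (k - 1) * μ.rexp (h b) ^ 2 := fun b => by
    rw [rexpList_sum_sq]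
    simp only [hs _ b]
  simp only [bilinearSum, rexpList_sum_sq, rexpList_add, rexpList_const_mul, rexp_list_sum,
    rexpList_rexp, h1, rexp_add, rexp_const_mul]
  ring

theorem rexpList_bilinearSum_variance_le (μ : PMF Ω) {h : Ω → Ω → ℝ} (hs : ∀ a b, h a b = h b a)
    (k : ℕ) (D : ℝ) (hD : (μ.rexp fun a => μ.rexp (h a)) = D) :
    (μ.rexpList k fun A => μ.rexpList k fun B => (bilinearSum h A B - k ^ 2 * D) ^ 2)
      ≤ k ^ 2 * (μ.rexp fun a => μ.rexp fun b => h a b ^ 2)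
        + 2 * k ^ 3 * (μ.rexp fun a => μ.rexp (h a) ^ 2) := by
  have h1 : ∀ A B : List Ω, (bilinearSum h A B - k ^ 2 * D) ^ 2
      = bilinearSum h A B ^ 2 + ((-2 * k ^ 2 * D) * bilinearSum h A B + (k ^ 2 * D) ^ 2) :=
    fun A B => by ring
  simp only [h1, rexpList_add, rexpList_const_mul, rexpList_const, rexpList_bilinearSum,
    rexpList_bilinearSum_sq μ hs, hD]
  have h2 : 0 ≤ μ.rexp fun a => μ.rexp (h a) ^ 2 := μ.rexp_nonneg fun a => sq_nonneg _
  have h3 : 0 ≤ (k : ℝ) ^ 2 * (μ.rexp fun a => μ.rexp (h a) ^ 2) := by positivity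
  rcases Nat.eq_zero_or_pos k with hk | hk
  · simp [hk]
  · have hk' : (1 : ℝ) ≤ k := by exact_mod_cast hk
    -- The disjoint pairs minus the squared mean leave `-k ^ 2 * (2 * k - 1) * D ^ 2`, which is
    -- dropped; the factor `2 * k - 1` has the right sign only for `k ≥ 1`.
    have h4 : 0 ≤ (k : ℝ) ^ 2 * (2 * k - 1) * D ^ 2 :=
      mul_nonneg (mul_nonneg (by positivity) (by linarith)) (sq_nonneg D)
    linarith

end PMF

namespace SampleProg

variable {ι X Ω : Type}

/-- A bilinear statistic of two groups of `k` outputs of `Q`. -/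
def bilinearStat (Q : SampleProg ι X Ω) (h : Ω → Ω → ℝ) (k : ℕ) : SampleProg ι X ℝ :=
  (Q.repeated k).bind fun A => (Q.repeated k).bind fun B => ret (PMF.bilinearSum h A B)

theorem maxSamples_bilinearStat_le (Q : SampleProg ι X Ω) (h : Ω → Ω → ℝ) (k : ℕ) {d : ℕ}
    (hd : Q.maxSamples ≤ d) : (Q.bilinearStat h k).maxSamples ≤ (2 * k * d : ℕ) := by
  have h1 := maxSamples_repeated_le Q hd k
  refine (maxSamples_bind_le _ _ h1 fun A => maxSamples_bind_le _ _ h1 fun B =>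
    maxSamples_ret_le _ 0).trans (le_of_eq ?_)
  rw [add_zero]
  norm_cast
  ring

/-- Chebyshev's inequality: Markov applied to the squared deviation, with the variance bound above.
-/
theorem prob_bilinearStat_le [Fintype Ω] (p : ι → PMF X) (Q : SampleProg ι X Ω) {h : Ω → Ω → ℝ}
    (hs : ∀ a b, h a b = h b a) (k : ℕ) {μ : PMF Ω} (hμ : Q.run p = μ) {D s : ℝ} (hs0 : 0 < s)
    (hD : (μ.rexp fun a => μ.rexp (h a)) = D) :
    ((Q.bilinearStat h k).run p).prob {z | s ≤ |z - k ^ 2 * D|}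
      ≤ ENNReal.ofReal ((k ^ 2 * (μ.rexp fun a => μ.rexp fun b => h a b ^ 2)
        + 2 * k ^ 3 * (μ.rexp fun a => μ.rexp (h a) ^ 2)) / s ^ 2) := by
  have h1 := ((Q.bilinearStat h k).run p).prob_mul_le_lexp (S := {z | s ≤ |z - k ^ 2 * D|})
    (f := fun z => ENNReal.ofReal ((z - k ^ 2 * D) ^ 2)) (c := ENNReal.ofReal (s ^ 2))
    fun z hz => ENNReal.ofReal_le_ofReal (by
      rw [← sq_abs (z - _)]
      exact pow_le_pow_left₀ hs0.le hz 2)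
  simp only [bilinearStat, run_bind, run_repeated, run_ret, hμ, PMF.lexp_bind, PMF.lexp_pure]
    at h1
  simp only [PMF.lexp_iidList_ofReal μ k (f := fun B => (PMF.bilinearSum h _ B - k ^ 2 * D) ^ 2)
    fun l => sq_nonneg _] at h1
  rw [PMF.lexp_iidList_ofReal μ k fun A => μ.rexpList_nonneg k fun l => sq_nonneg _] at h1
  rw [ENNReal.ofReal_div_of_pos (by positivity), ENNReal.le_div_iff_mul_le
    (Or.inl (by simpa using hs0.ne')) (Or.inl ENNReal.ofReal_ne_top), mul_comm]
  simp only [bilinearStat, run_bind, run_repeated, run_ret, hμ]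
  exact h1.trans (ENNReal.ofReal_le_ofReal (μ.rexpList_bilinearSum_variance_le hs k D hD))

end SampleProg

end

/-! ### Existence of norm estimators: collision counts and medians -/

open scoped ENNReal

noncomputable section

/-! ### Amplification by independent repetitions -/

/-- The number of repetitions that reduces the failure probability to `δ`. -/
def repetitions (δ : ℝ) : ℕ := ⌈Real.log (1 / δ) / Real.log 2⌉₊

theorem half_pow_repetitions_le {δ : ℝ} (hδ : 0 < δ) : (1 / 2 : ℝ) ^ repetitions δ ≤ δ := by
  have hlog : 0 < Real.log 2 := Real.log_pos (by norm_num)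
  have h1 : Real.log (1 / δ) ≤ repetitions δ * Real.log 2 :=
    (div_le_iff₀ hlog).1 (Nat.le_ceil _)
  rw [← Real.log_pow] at h1
  have h2 := (Real.log_le_log_iff (by positivity) (by positivity)).1 h1
  rw [one_div, inv_pow]
  rw [one_div] at h2
  exact (inv_le_comm₀ hδ (by positivity)).1 h2

theorem log_one_div_ge {δ : ℝ} (hδ : 0 < δ) (hδ' : δ ≤ 1 / 2) :
    Real.log 2 ≤ Real.log (1 / δ) :=
  Real.log_le_log (by norm_num) (by rw [le_div_iff₀ hδ]; linarith)

/-- As `log (1 / δ) ≥ log 2 > 2/3`, dividing by `log 2` costs at most a factor `3/2`, and the `+ 1`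
of the ceiling is at most another `3/2 * log (1 / δ)`. -/
theorem repetitions_le {δ : ℝ} (hδ : 0 < δ) (hδ' : δ ≤ 1 / 2) :
    (repetitions δ : ℝ) ≤ 3 * Real.log (1 / δ) := by
  have hlog := Real.log_two_gt_d9
  have h0 := log_one_div_ge hδ hδ'
  have h1 : (repetitions δ : ℝ) < Real.log (1 / δ) / Real.log 2 + 1 :=
    Nat.ceil_lt_add_one (div_nonneg (by linarith) (by linarith))
  have h2 : Real.log (1 / δ) / Real.log 2 ≤ 3 / 2 * Real.log (1 / δ) := by
    rw [div_le_iff₀ (by linarith)]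
    nlinarith
  linarith

namespace SampleProg

variable {ι X R : Type}

open Classical in
theorem prob_repeated_majority_le (P : SampleProg ι X R) (p : ι → PMF X) (S : Set R)
    (hS : (P.run p).prob S ≤ ENNReal.ofReal (1 / 16)) {δ : ℝ} (hδ : 0 < δ) :
    ((P.repeated (repetitions δ)).run p).prob
      {l | l.length ≤ 2 * l.countP (fun x => decide (x ∈ S))} ≤ ENNReal.ofReal δ := by
  rw [run_repeated]
  refine le_trans (PMF.prob_mono_support _ fun l hl hl' => ?_)
    (((P.run p).prob_majority_le S hS (repetitions δ)).trans
      (ENNReal.ofReal_le_ofReal (half_pow_repetitions_le hδ)))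
  have := (P.run p).support_iidList_length _ l hl
  simpa only [Set.mem_ofPred_eq, this] using hl'

end SampleProg

/-! ### Basic facts on the squared `ℓ₂`-norm -/

theorem one_le_card_mul_l2NormSq {N : ℕ} (p : PMF (Fin N)) : 1 ≤ N * l2NormSq p := by
  have h := sq_sum_le_card_mul_sum_sq (s := Finset.univ) (f := fun x => (p x).toReal)
  rw [p.toReal_sum_eq_one] at h
  simpa [l2NormSq] using h

theorem l2NormSq_nonneg {X : Type} [Fintype X] (p : PMF X) : 0 ≤ l2NormSq p :=
  Finset.sum_nonneg fun _ _ => sq_nonneg _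

theorem toReal_apply_le_sqrt_l2NormSq {X : Type} [Fintype X] (p : PMF X) (x : X) :
    (p x).toReal ≤ √(l2NormSq p) :=
  Real.le_sqrt_of_sq_le
    (Finset.single_le_sum (f := fun x => (p x).toReal ^ 2) (fun _ _ => sq_nonneg _)
      (Finset.mem_univ x))

theorem rexp_toReal_apply {X : Type} [Fintype X] (p : PMF X) :
    (p.rexp fun x => (p x).toReal) = l2NormSq p :=
  Finset.sum_congr rfl fun _ _ => (sq _).symm

theorem rexp_ite_eq {X : Type} [Fintype X] [DecidableEq X] (p : PMF X) (a : X) :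
    (p.rexp fun b => if a = b then 1 else 0) = (p a).toReal := by
  simp [PMF.rexp]

/-! ### The norm estimator -/

open SampleProg

/-- The size of each of the two groups of samples of the collision estimator. -/
def collisionSize (N : ℕ) : ℕ := ⌈256 * √(N : ℝ)⌉₊

/-- Estimate the squared `ℓ₂`-norm by the rate of collisions between two groups of samples. -/
def collisionEstimator (N : ℕ) : SampleProg Unit (Fin N) ℝ :=
  (bilinearStat (sample ()) (fun a b => if a = b then 1 else 0) (collisionSize N)).bind
    fun z => ret (z / (collisionSize N : ℝ) ^ 2)

/-- The equality kernel has mean and second moment `D = ‖p‖₂²`, and its conditional means `p a`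
satisfy `∑ (p a) ^ 3 ≤ D ^ (3/2)`. With `y = k * √D` the variance is at most `y ^ 2 + 2 * y ^ 3`,
against the squared tolerance `y ^ 4 / 4`. Here `y ≥ 256`, because `k ≥ 256 * √N` and `N * D ≥ 1`.
-/
theorem prob_collisionEstimator_le {N : ℕ} (p : PMF (Fin N)) :
    ((collisionEstimator N).run fun _ => p).prob
      {L | l2NormSq p / 2 ≤ L ∧ L ≤ 3 * l2NormSq p / 2}ᶜ ≤ ENNReal.ofReal (1 / 16) := by
  set D := l2NormSq p with hDdef
  set k := collisionSize N with hk
  have hND : 1 ≤ N * D := one_le_card_mul_l2NormSq p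
  have hD0 : 0 ≤ D := l2NormSq_nonneg p
  have hDpos : 0 < D := by
    rcases hD0.eq_or_lt with h | h
    · rw [← h] at hND; norm_num at hND
    · exact h
  have hkN : 256 * √(N : ℝ) ≤ k := Nat.le_ceil _
  have hx : 256 ≤ k * √D := by
    have h1 : 1 ≤ √(N : ℝ) * √D := by
      rw [← Real.sqrt_mul (by positivity)]; exact Real.one_le_sqrt.2 hND
    nlinarith [Real.sqrt_nonneg D]
  have hkpos : (0 : ℝ) < k := by
    by_contra h
    nlinarith [Real.sqrt_nonneg D]
  have hh1 : ∀ a, (p.rexp fun b => if a = b then (1 : ℝ) else 0) = (p a).toReal := rexp_ite_eq p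
  have hcheb := prob_bilinearStat_le (fun _ : Unit => p) (sample ())
    (h := fun a b : Fin N => if a = b then 1 else 0) (fun a b => by simp [eq_comm]) k
    (run_sample _ _) (D := D) (s := k ^ 2 * D / 2) (by positivity)
    (by simp only [hh1]; exact rexp_toReal_apply p)
  rw [collisionEstimator, run_bind, ← add_zero (ENNReal.ofReal (1 / 16))]
  refine (PMF.prob_bind_le _ _ {z | k ^ 2 * D / 2 ≤ |z - k ^ 2 * D|} _ 0 fun z hz => ?_).trans ?_
  · rw [run_ret, PMF.prob_pure, if_neg]
    simp only [Set.mem_ofPred_eq, not_le, abs_lt] at hz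
    have hk2 : (0 : ℝ) < k ^ 2 := by positivity
    rw [Set.notMem_compl_iff]
    constructor
    · rw [le_div_iff₀ hk2]; nlinarith
    · rw [div_le_iff₀ hk2]; nlinarith
  · gcongr
    refine hcheb.trans (ENNReal.ofReal_le_ofReal ?_)
    have e1 : (p.rexp fun a => p.rexp fun b => (if a = b then (1 : ℝ) else 0) ^ 2) = D := by
      simp only [ite_pow, one_pow, ne_eq, OfNat.ofNat_ne_zero, not_false_eq_true, zero_pow, hh1]
      exact rexp_toReal_apply p
    have e2 : (p.rexp fun a => (p.rexp fun b => if a = b then (1 : ℝ) else 0) ^ 2) ≤ √D * D := by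
      simp only [hh1]
      calc (p.rexp fun a => (p a).toReal ^ 2) ≤ p.rexp fun a => √D * (p a).toReal :=
            p.rexp_mono fun a => by
              rw [sq]
              exact mul_le_mul_of_nonneg_right (toReal_apply_le_sqrt_l2NormSq p a)
                ENNReal.toReal_nonneg
        _ = √D * D := by rw [PMF.rexp_const_mul, rexp_toReal_apply]
    rw [e1, div_le_iff₀ (by positivity)]
    obtain ⟨x, hxD, hx0⟩ : ∃ x, x ^ 2 = D ∧ √D = x := ⟨√D, Real.sq_sqrt hD0, rfl⟩
    rw [hx0] at e2 hx
    have hxpos : 0 < x := hx0 ▸ Real.sqrt_pos.2 hDpos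
    have e3 : 2 * (k : ℝ) ^ 3 * (p.rexp fun a => (p.rexp fun b => if a = b then (1 : ℝ) else 0) ^ 2)
        ≤ 2 * k ^ 3 * (x * D) := by gcongr
    refine (add_le_add_right e3 _).trans ?_
    rw [← hxD]
    -- What remains is `y ^ 2 + 2 * y ^ 3 ≤ y ^ 4 / 64` for `y = k * x ≥ 256`.
    have h3 : 256 * (k * x) ^ 3 ≤ (k * x) ^ 4 := by
      rw [pow_succ (k * x) 3, mul_comm]
      exact mul_le_mul_of_nonneg_left hx (by positivity)
    have h2 : 256 * (k * x) ^ 2 ≤ (k * x) ^ 3 := by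
      rw [pow_succ (k * x) 2, mul_comm]
      exact mul_le_mul_of_nonneg_left hx (by positivity)
    nlinarith

/-- A median-like value of a list of reals. -/
def upperMedian (l : List ℝ) : ℝ := sSup {t | l.length < 2 * l.countP (fun L => decide (t ≤ L))}

/-- A majority of the entries is good, so `a` is an admissible threshold. A threshold above `b` is
met by bad entries only, a minority. Hence the supremum is over a nonempty set bounded by `b`. -/
theorem upperMedian_mem_Icc {l : List ℝ} {a b : ℝ} {bad : ℝ → Bool}
    (hbad : ∀ L, bad L = false → a ≤ L ∧ L ≤ b) (h : 2 * l.countP bad < l.length) :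
    upperMedian l ∈ Set.Icc a b := by
  have hsplit := l.length_eq_countP_add_countP bad
  have ha : a ∈ {t | l.length < 2 * l.countP (fun L => decide (t ≤ L))} := by
    have : l.countP (fun L => decide (¬ bad L = true)) ≤ l.countP (fun L => decide (a ≤ L)) :=
      List.countP_mono_left fun L _ hL => by
        simp only [Bool.not_eq_true, decide_eq_true_eq] at hL ⊢
        exact (hbad L hL).1
    rw [Set.mem_ofPred_eq]
    omega
  have hb : ∀ t ∈ {t | l.length < 2 * l.countP (fun L => decide (t ≤ L))}, t ≤ b := by
    intro t ht
    by_contra hbt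
    have : l.countP (fun L => decide (t ≤ L)) ≤ l.countP bad :=
      List.countP_mono_left fun L _ hL => by
        by_contra hL'
        have := (hbad L (by simpa using hL')).2
        simp only [decide_eq_true_eq] at hL
        linarith
    rw [Set.mem_ofPred_eq] at ht
    omega
  exact ⟨le_csSup ⟨b, hb⟩ ha, csSup_le ⟨a, ha⟩ hb⟩

/-- The norm estimator: a median of independent collision estimates. -/
def normEstimator (N : ℕ) (δ : ℝ) : SampleProg Unit (Fin N) ℝ :=
  ((collisionEstimator N).repeated (repetitions δ)).bind fun l => ret (upperMedian l)

theorem isL2NormEstimator_normEstimator : IsL2NormEstimator normEstimator := by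
  -- `1542 = 3 * 2 * 257`: repetitions, two groups, and the group size with its ceiling.
  refine ⟨1542, by norm_num, fun N δ hδ hδ' => ⟨?_, fun p => ?_⟩⟩
  · refine ⟨repetitions δ * (2 * collisionSize N * 1), ?_, ?_⟩
    · rw [← add_zero ((_ : ℕ) : ℕ∞)]
      refine maxSamples_bind_le _ _ (maxSamples_repeated_le _ ?_ _) fun _ => maxSamples_ret_le _ _
      rw [← add_zero ((_ : ℕ) : ℕ∞)]
      exact maxSamples_bind_le _ _ (maxSamples_bilinearStat_le _ _ _
        (by exact_mod_cast maxSamples_sample_le _)) fun _ => maxSamples_ret_le _ _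
    · have h1 := repetitions_le hδ hδ'
      have h2 : (collisionSize N : ℝ) ≤ 257 * √(N : ℝ) := by
        -- For `N ≥ 1` the `+ 1` of the ceiling is absorbed by `√N ≥ 1`; for `N = 0` the group is
        -- empty.
        rcases Nat.eq_zero_or_pos N with h | h
        · simp [h, collisionSize]
        · have h3 : 1 ≤ √(N : ℝ) := Real.one_le_sqrt.2 (by exact_mod_cast h)
          have h4 : (collisionSize N : ℝ) < 256 * √(N : ℝ) + 1 :=
            Nat.ceil_lt_add_one (by positivity)
          linarith
      have h0 := h1.trans' (Nat.cast_nonneg _)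
      push_cast
      calc (repetitions δ : ℝ) * (2 * collisionSize N * 1)
          ≤ 3 * Real.log (1 / δ) * (2 * (257 * √(N : ℝ)) * 1) := by gcongr
        _ = 1542 * (√(N : ℝ) * Real.log (1 / δ)) := by ring
  · classical
    refine PMF.one_sub_le_prob_of_prob_compl_le hδ.le ?_
    rw [normEstimator, run_bind, ← add_zero (ENNReal.ofReal δ)]
    refine (PMF.prob_bind_le _ _ _ _ 0 fun l hl => ?_).trans (add_le_add_left
      (prob_repeated_majority_le _ _ _ (prob_collisionEstimator_le p) hδ) 0)
    rw [run_ret, PMF.prob_pure, if_neg]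
    rw [Set.notMem_compl_iff]
    rw [Set.mem_ofPred_eq, not_le] at hl
    exact upperMedian_mem_Icc (fun L hL => by simpa using hL) hl

end

/-! ### Existence of closeness testers: an unbiased estimate of the squared distance -/

open scoped ENNReal

noncomputable section

/-! ### Products of distributions -/

namespace PMF

variable {X Y : Type}

/-- The product of two distributions. -/
def prodLaw (p : PMF X) (q : PMF Y) : PMF (X × Y) :=
  p.bind fun x => q.bind fun y => PMF.pure (x, y)

theorem prodLaw_apply (p : PMF X) (q : PMF Y) (x : X) (y : Y) :
    p.prodLaw q (x, y) = p x * q y := by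
  rw [prodLaw, PMF.bind_apply, tsum_eq_single x, PMF.bind_apply, tsum_eq_single y]
  · simp
  · intro y' hy'
    simp [PMF.pure_apply, hy'.symm]
  · intro x' hx'
    simp [PMF.bind_apply, PMF.pure_apply, hx'.symm]

variable [Fintype X] [Fintype Y]

theorem rexp_prodLaw (p : PMF X) (q : PMF Y) (f : X × Y → ℝ) :
    (p.prodLaw q).rexp f = p.rexp fun x => q.rexp fun y => f (x, y) := by
  simp only [rexp, Fintype.sum_prod_type, prodLaw_apply, ENNReal.toReal_mul, Finset.mul_sum,
    mul_assoc]

theorem rexp_prodLaw_fst (p : PMF X) (q : PMF Y) (f : X → ℝ) :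
    ((p.prodLaw q).rexp fun a => f a.1) = p.rexp f := by
  simp only [rexp_prodLaw, rexp_const]

theorem rexp_prodLaw_snd (p : PMF X) (q : PMF Y) (f : Y → ℝ) :
    ((p.prodLaw q).rexp fun a => f a.2) = q.rexp f := by
  simp only [rexp_prodLaw, rexp_const]

end PMF

/-! ### The closeness statistic -/

section L2Dist

variable {X : Type} [Fintype X] (p q : PMF X)

/-- The squared `ℓ₂`-distance of two distributions. -/
def l2DistSq : ℝ := ∑ x, ((p x).toReal - (q x).toReal) ^ 2

theorem l2DistSq_nonneg : 0 ≤ l2DistSq p q := Finset.sum_nonneg fun _ _ => sq_nonneg _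

/-- The promise bounds only the smaller norm. The larger one exceeds it by an amount controlled by
the squared distance, that is, by the signal the statistic is meant to detect. -/
theorem l2NormSq_add_le {b : ℝ} (hb : min (l2NormSq p) (l2NormSq q) ≤ b) :
    l2NormSq p ≤ 2 * b + 2 * l2DistSq p q ∧ l2NormSq q ≤ 2 * b + 2 * l2DistSq p q := by
  have h1 : l2NormSq p ≤ 2 * l2NormSq q + 2 * l2DistSq p q := by
    simp only [l2NormSq, l2DistSq, Finset.mul_sum, ← Finset.sum_add_distrib]
    exact Finset.sum_le_sum fun x _ => by
      nlinarith [sq_nonneg ((p x).toReal - 2 * (q x).toReal)]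
  have h2 : l2NormSq q ≤ 2 * l2NormSq p + 2 * l2DistSq p q := by
    simp only [l2NormSq, l2DistSq, Finset.mul_sum, ← Finset.sum_add_distrib]
    exact Finset.sum_le_sum fun x _ => by
      nlinarith [sq_nonneg (2 * (p x).toReal - (q x).toReal)]
  have := l2DistSq_nonneg p q
  have := l2NormSq_nonneg p
  have := l2NormSq_nonneg q
  rcases min_le_iff.1 hb with h | h <;> constructor <;> linarith

end L2Dist

section ClosenessKernel

variable {X : Type} [DecidableEq X]

/-- The inner product of `e_x - e_y` and `e_x' - e_y'`. -/
def closenessKernel (a b : X × X) : ℝ :=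
  (if a.1 = b.1 then 1 else 0) + (if a.2 = b.2 then 1 else 0)
    - (if a.1 = b.2 then 1 else 0) - (if a.2 = b.1 then 1 else 0)

theorem closenessKernel_comm (a b : X × X) : closenessKernel a b = closenessKernel b a := by
  simp only [closenessKernel, eq_comm (a := a.1), eq_comm (a := a.2)]
  ring

theorem closenessKernel_sq_le (a b : X × X) : closenessKernel a b ^ 2 ≤
    4 * ((if a.1 = b.1 then 1 else 0) + (if a.2 = b.2 then 1 else 0)
      + (if a.1 = b.2 then 1 else 0) + (if a.2 = b.1 then 1 else 0)) := by
  unfold closenessKernel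
  split_ifs <;> norm_num

variable [Fintype X] (p q : PMF X)

/-- Averaging `e_x' - e_y'` gives `p - q`, whose inner product with `e_x - e_y` is the right-hand
side. A second average gives `‖p - q‖₂²`. -/
theorem rexp_closenessKernel (a : X × X) : (p.prodLaw q).rexp (closenessKernel a)
    = ((p a.1).toReal - (q a.1).toReal) - ((p a.2).toReal - (q a.2).toReal) := by
  unfold closenessKernel
  rw [PMF.rexp_sub, PMF.rexp_sub, PMF.rexp_add,
    PMF.rexp_prodLaw_fst p q (fun b => if a.1 = b then (1 : ℝ) else 0),
    PMF.rexp_prodLaw_fst p q (fun b => if a.2 = b then (1 : ℝ) else 0),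
    PMF.rexp_prodLaw_snd p q (fun b => if a.1 = b then (1 : ℝ) else 0),
    PMF.rexp_prodLaw_snd p q (fun b => if a.2 = b then (1 : ℝ) else 0)]
  simp only [rexp_ite_eq]
  ring

theorem rexp_rexp_closenessKernel :
    ((p.prodLaw q).rexp fun a => (p.prodLaw q).rexp (closenessKernel a)) = l2DistSq p q := by
  simp only [rexp_closenessKernel]
  rw [PMF.rexp_sub, PMF.rexp_prodLaw_fst p q (fun x => (p x).toReal - (q x).toReal),
    PMF.rexp_prodLaw_snd p q (fun x => (p x).toReal - (q x).toReal), PMF.rexp, PMF.rexp,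
    ← Finset.sum_sub_distrib]
  exact Finset.sum_congr rfl fun x _ => by ring

theorem rexp_closenessKernel_sq_le :
    ((p.prodLaw q).rexp fun a => (p.prodLaw q).rexp fun b => closenessKernel a b ^ 2)
      ≤ 8 * (l2NormSq p + l2NormSq q) := by
  have h1 : ∀ a : X × X, ((p.prodLaw q).rexp fun b => closenessKernel a b ^ 2)
      ≤ 4 * ((p a.1).toReal + (q a.2).toReal + (q a.1).toReal + (p a.2).toReal) := fun a => by
    refine ((p.prodLaw q).rexp_mono (closenessKernel_sq_le a)).trans (le_of_eq ?_)
    rw [PMF.rexp_const_mul, PMF.rexp_add, PMF.rexp_add, PMF.rexp_add,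
      PMF.rexp_prodLaw_fst p q (fun b => if a.1 = b then (1 : ℝ) else 0),
      PMF.rexp_prodLaw_fst p q (fun b => if a.2 = b then (1 : ℝ) else 0),
      PMF.rexp_prodLaw_snd p q (fun b => if a.1 = b then (1 : ℝ) else 0),
      PMF.rexp_prodLaw_snd p q (fun b => if a.2 = b then (1 : ℝ) else 0)]
    simp only [rexp_ite_eq]
  refine ((p.prodLaw q).rexp_mono h1).trans ?_
  rw [PMF.rexp_const_mul, PMF.rexp_add, PMF.rexp_add, PMF.rexp_add,
    PMF.rexp_prodLaw_fst p q (fun x => (p x).toReal), PMF.rexp_prodLaw_fst p q (fun x => (q x).toReal),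
    PMF.rexp_prodLaw_snd p q (fun x => (p x).toReal), PMF.rexp_prodLaw_snd p q (fun x => (q x).toReal)]
  simp only [PMF.rexp, l2NormSq, ← Finset.sum_add_distrib, Finset.mul_sum]
  exact Finset.sum_le_sum fun x _ => by nlinarith [sq_nonneg ((p x).toReal - (q x).toReal)]

/-- The conditional means are differences of entries of `p - q`, so their second moment is at most
`2 * ∑ (p x + q x) * (p x - q x) ^ 2`, and each entry is at most the norm. The bound vanishes when
`p = q`. -/
theorem rexp_rexp_closenessKernel_sq_le :
    ((p.prodLaw q).rexp fun a => (p.prodLaw q).rexp (closenessKernel a) ^ 2)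
      ≤ 2 * (√(l2NormSq p) + √(l2NormSq q)) * l2DistSq p q := by
  have h1 : ∀ a : X × X, (p.prodLaw q).rexp (closenessKernel a) ^ 2
      ≤ 2 * (((p a.1).toReal - (q a.1).toReal) ^ 2 + ((p a.2).toReal - (q a.2).toReal) ^ 2) :=
    fun a => by
      rw [rexp_closenessKernel]
      nlinarith [sq_nonneg (((p a.1).toReal - (q a.1).toReal) + ((p a.2).toReal - (q a.2).toReal))]
  refine ((p.prodLaw q).rexp_mono h1).trans ?_
  rw [PMF.rexp_const_mul, PMF.rexp_add,
    PMF.rexp_prodLaw_fst p q (fun x => ((p x).toReal - (q x).toReal) ^ 2),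
    PMF.rexp_prodLaw_snd p q (fun x => ((p x).toReal - (q x).toReal) ^ 2), mul_assoc]
  gcongr
  simp only [PMF.rexp, l2DistSq, ← Finset.sum_add_distrib, Finset.mul_sum, ← add_mul]
  exact Finset.sum_le_sum fun x _ => mul_le_mul_of_nonneg_right
    (add_le_add (toReal_apply_le_sqrt_l2NormSq p x) (toReal_apply_le_sqrt_l2NormSq q x))
    (sq_nonneg _)

end ClosenessKernel

/-- Cauchy–Schwarz; the 4 undoes the factor `1/2` in total variation. The acceptance threshold `2 *
ε ^ 2 / N` is half of the resulting bound on the squared distance. -/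
theorem four_mul_sq_le_card_mul_l2DistSq {N : ℕ} (p q : PMF (Fin N)) {ε : ℝ} (hε : 0 < ε)
    (h : ε ≤ tvDist p q) : 4 * ε ^ 2 ≤ N * l2DistSq p q := by
  have h1 := sq_sum_le_card_mul_sum_sq (s := Finset.univ)
    (f := fun x => |(p x).toReal - (q x).toReal|)
  simp only [sq_abs, Finset.card_univ, Fintype.card_fin] at h1
  unfold tvDist at h
  unfold l2DistSq
  nlinarith

/-! ### The closeness tester -/

open SampleProg

/-- One sample from each of the two distributions. -/
def samplePair {X : Type} : SampleProg Bool X (X × X) :=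
  (sample false).bind fun x => (sample true).bind fun y => ret (x, y)

theorem run_samplePair {X : Type} (p q : PMF X) :
    samplePair.run (fun i => bif i then q else p) = p.prodLaw q := by
  simp only [samplePair, run_bind, run_sample, run_ret, PMF.prodLaw, cond_true, cond_false]

theorem maxSamples_samplePair_le {X : Type} :
    (samplePair : SampleProg Bool X (X × X)).maxSamples ≤ (2 : ℕ) :=
  (maxSamples_bind_le _ _ (maxSamples_sample_le _) fun _ => maxSamples_bind_le _ _
    (maxSamples_sample_le _) fun _ => maxSamples_ret_le _ 0).trans (by norm_num)

/-- The size of each of the two groups of sample pairs of the `ℓ₂`-distance estimator. -/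
def closenessSize (N : ℕ) (b ε : ℝ) : ℕ := ⌈1024 * (N * √b / ε ^ 2)⌉₊

/-- Accept if and only if the estimate of the squared `ℓ₂`-distance is small. -/
def l2ClosenessTester (N : ℕ) (b ε : ℝ) : SampleProg Bool (Fin N) Bool :=
  (bilinearStat samplePair closenessKernel (closenessSize N b ε)).bind fun z =>
    ret (decide (z < (closenessSize N b ε : ℝ) ^ 2 * (2 * ε ^ 2 / N)))

theorem sqrt_add_le_of_le {x b D : ℝ} (hb : 0 ≤ b) (hD : 0 ≤ D) (h : x ≤ 2 * b + 2 * D) :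
    √x ≤ 3 / 2 * (√b + √D) := by
  refine Real.sqrt_le_iff.2 ⟨by positivity, h.trans ?_⟩
  have h1 := Real.sq_sqrt hb
  have h2 := Real.sq_sqrt hD
  have h3 : 0 ≤ √b * √D := by positivity
  nlinarith

section L2Closeness

variable {N : ℕ} {p q : PMF (Fin N)} {b ε : ℝ}

theorem prob_closenessStat_le (hb : 0 ≤ b) (hpq : min (l2NormSq p) (l2NormSq q) ≤ b) (k : ℕ)
    {s : ℝ} (hs : 0 < s) :
    (((bilinearStat samplePair closenessKernel k).run fun i => bif i then q else p)).prob
        {z | s ≤ |z - k ^ 2 * l2DistSq p q|}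
      ≤ ENNReal.ofReal ((k ^ 2 * (32 * (b + l2DistSq p q))
        + 12 * k ^ 3 * ((√b + √(l2DistSq p q)) * l2DistSq p q)) / s ^ 2) := by
  refine (prob_bilinearStat_le _ _ closenessKernel_comm k (run_samplePair p q) hs
    (rexp_rexp_closenessKernel p q)).trans (ENNReal.ofReal_le_ofReal ?_)
  obtain ⟨hp, hq⟩ := l2NormSq_add_le p q hpq
  have hD := l2DistSq_nonneg p q
  have h1 : ((p.prodLaw q).rexp fun a => (p.prodLaw q).rexp fun b => closenessKernel a b ^ 2)
      ≤ 32 * (b + l2DistSq p q) := (rexp_closenessKernel_sq_le p q).trans (by linarith)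
  have h2 : ((p.prodLaw q).rexp fun a => (p.prodLaw q).rexp (closenessKernel a) ^ 2)
      ≤ 6 * ((√b + √(l2DistSq p q)) * l2DistSq p q) := by
    refine (rexp_rexp_closenessKernel_sq_le p q).trans ?_
    rw [← mul_assoc]
    refine mul_le_mul_of_nonneg_right ?_ hD
    linarith [sqrt_add_le_of_le hb hD hp, sqrt_add_le_of_le hb hD hq]
  refine div_le_div_of_nonneg_right ?_ (sq_nonneg s)
  have h3 := mul_le_mul_of_nonneg_left h2 (by positivity : (0 : ℝ) ≤ 2 * k ^ 3)
  have h4 := mul_le_mul_of_nonneg_left h1 (by positivity : (0 : ℝ) ≤ k ^ 2)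
  linarith

/-- With distance zero only the term `32 * k ^ 2 * b` of the variance survives, and the choice of
`k` makes `k * ε ^ 2 / N` at least `1024 * √b`. -/
theorem prob_l2ClosenessTester_eq (hb : 0 < b) (hε : 0 < ε) (hN : 1 ≤ N * b)
    (hpb : min (l2NormSq p) (l2NormSq q) ≤ b) (hpq : p = q) :
    ((l2ClosenessTester N b ε).run fun i => bif i then q else p).prob {true}ᶜ
      ≤ ENNReal.ofReal (1 / 16) := by
  set k := closenessSize N b ε with hk
  have hNpos : (0 : ℝ) < N := by
    by_contra h
    nlinarith
  have hk1 : 1024 * (N * √b / ε ^ 2) ≤ k := Nat.le_ceil _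
  have hkpos : (0 : ℝ) < k := lt_of_lt_of_le (by positivity) hk1
  have hD : l2DistSq p q = 0 := by simp [hpq, l2DistSq]
  have hcheb := prob_closenessStat_le hb.le hpb k (s := k ^ 2 * (2 * ε ^ 2 / N)) (by positivity)
  rw [hD] at hcheb
  rw [l2ClosenessTester, run_bind, ← add_zero (ENNReal.ofReal (1 / 16))]
  refine (PMF.prob_bind_le _ _ {z | k ^ 2 * (2 * ε ^ 2 / N) ≤ |z - (k : ℝ) ^ 2 * 0|} _ 0
    fun z hz => ?_).trans ?_
  · rw [run_ret, PMF.prob_pure, if_neg]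
    simp only [Set.mem_ofPred_eq, not_le, mul_zero, sub_zero] at hz
    simpa using (abs_lt.1 hz).2
  · gcongr
    refine hcheb.trans (ENNReal.ofReal_le_ofReal ?_)
    rw [div_le_iff₀ (by positivity)]
    have h1 : 1024 * √b ≤ k * (ε ^ 2 / N) := by
      rw [mul_div_assoc', le_div_iff₀ hNpos]
      rw [mul_div_assoc', div_le_iff₀ (by positivity)] at hk1
      linarith
    have h2 : (1024 * √b) ^ 2 ≤ (k * (ε ^ 2 / N)) ^ 2 := pow_le_pow_left₀ (by positivity) h1 2
    rw [mul_pow, Real.sq_sqrt hb.le] at h2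
    have h3 := mul_le_mul_of_nonneg_left h2 (sq_nonneg (k : ℝ))
    have h4 : 0 ≤ (k : ℝ) ^ 2 * b := by positivity
    have e : (2 * ε ^ 2 / N) = 2 * (ε ^ 2 / N) := by ring
    rw [e]
    nlinarith

/-- A deviation below half the mean keeps the statistic above the threshold. The four variance terms
are compared with `k ^ 4 * D ^ 2` through `k * D ≥ 4096 * √b` for the terms with `b`, and `k * √D ≥
2048` for the others. -/
theorem prob_l2ClosenessTester_far (hb : 0 < b) (hε : 0 < ε) (hε' : ε < 1) (hN : 1 ≤ N * b)
    (hpb : min (l2NormSq p) (l2NormSq q) ≤ b) (hpq : ε ≤ tvDist p q) :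
    ((l2ClosenessTester N b ε).run fun i => bif i then q else p).prob {false}ᶜ
      ≤ ENNReal.ofReal (1 / 16) := by
  set k := closenessSize N b ε with hk
  have hNpos : (0 : ℝ) < N := by
    by_contra h
    nlinarith
  have hk1 : 1024 * (N * √b / ε ^ 2) ≤ k := Nat.le_ceil _
  have hkpos : (0 : ℝ) < k := lt_of_lt_of_le (by positivity) hk1
  have hND := four_mul_sq_le_card_mul_l2DistSq p q hε hpq
  have hcheb := prob_closenessStat_le hb.le hpb k (s := k ^ 2 * l2DistSq p q / 2)
  set D := l2DistSq p q with hDdef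
  have hDpos : 0 < D := by
    by_contra h
    nlinarith [sq_pos_of_pos hε]
  rw [l2ClosenessTester, run_bind, ← add_zero (ENNReal.ofReal (1 / 16))]
  refine (PMF.prob_bind_le _ _ {z | k ^ 2 * D / 2 ≤ |z - k ^ 2 * D|} _ 0
    fun z hz => ?_).trans ?_
  · rw [run_ret, PMF.prob_pure, if_neg]
    simp only [Set.mem_ofPred_eq, not_le] at hz
    have h1 := (abs_lt.1 hz).1
    have h2 : (k : ℝ) ^ 2 * (2 * ε ^ 2 / N) ≤ k ^ 2 * (D / 2) := by
      refine mul_le_mul_of_nonneg_left ?_ (sq_nonneg _)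
      rw [div_le_iff₀ hNpos]
      linarith
    simp only [Set.mem_compl_iff, Set.mem_singleton_iff, decide_eq_false_iff_not, not_not, not_lt]
    linarith
  · gcongr
    refine (hcheb (by positivity)).trans (ENNReal.ofReal_le_ofReal ?_)
    rw [div_le_iff₀ (by positivity)]
    set x := √D with hx
    set β := √b with hβ
    have hxpos : 0 < x := Real.sqrt_pos.2 hDpos
    have hβpos : 0 < β := Real.sqrt_pos.2 hb
    have hxD : D = x ^ 2 := (Real.sq_sqrt hDpos.le).symm
    have hβb : b = β ^ 2 := (Real.sq_sqrt hb.le).symm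
    rw [mul_div_assoc', div_le_iff₀ (by positivity)] at hk1
    have h1 : 4096 * β ≤ k * x ^ 2 := by
      rw [← hxD]
      have h2 : k * (4 * ε ^ 2) ≤ k * (N * D) := by gcongr
      have h3 : N * (4096 * β) ≤ N * (k * D) := by linarith
      exact le_of_mul_le_mul_left h3 hNpos
    -- From `√N * √b ≥ 1` one gets `k * ε ^ 2 ≥ 1024 * √N`; since `ε < 1` this also bounds `k * ε`,
    -- and `2 * ε ≤ √N * x` converts it.
    have h2 : 2048 ≤ k * x := by
      have hNβ : 1 ≤ √(N : ℝ) * β := by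
        rw [hβ, ← Real.sqrt_mul hNpos.le]; exact Real.one_le_sqrt.2 hN
      have hεx : 2 * ε ≤ √(N : ℝ) * x := by
        rw [hx, ← Real.sqrt_mul hNpos.le]
        exact Real.le_sqrt_of_sq_le (by linarith)
      have hsN : √(N : ℝ) * √(N : ℝ) = N := Real.mul_self_sqrt hNpos.le
      have hsNpos : 0 < √(N : ℝ) := Real.sqrt_pos.2 hNpos
      have h4 : 1024 * √(N : ℝ) ≤ k * ε ^ 2 := by
        refine le_trans ?_ hk1
        have := mul_le_mul_of_nonneg_left hNβ hsNpos.le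
        rw [← mul_assoc, hsN] at this
        linarith
      have h5 : k * ε ^ 2 ≤ k * ε := by
        gcongr
        nlinarith
      have h6 : k * (2 * ε) ≤ k * (√(N : ℝ) * x) := by gcongr
      have h7 : √(N : ℝ) * 2048 ≤ √(N : ℝ) * (k * x) := by linarith
      exact le_of_mul_le_mul_left h7 hsNpos
    rw [hxD, hβb]
    have g1 : (4096 * (k * β)) ^ 2 ≤ (k ^ 2 * x ^ 2) ^ 2 := by
      refine pow_le_pow_left₀ (by positivity) ?_ 2
      have := mul_le_mul_of_nonneg_left h1 hkpos.le
      linarith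
    have g2 : 4096 * (k * β) * (k ^ 2 * x ^ 2) ≤ (k ^ 2 * x ^ 2) * (k ^ 2 * x ^ 2) := by
      refine mul_le_mul_of_nonneg_right ?_ (by positivity)
      have := mul_le_mul_of_nonneg_left h1 hkpos.le
      linarith
    have g3 : 2048 * (k * x) ^ 3 ≤ (k * x) * (k * x) ^ 3 := by
      exact mul_le_mul_of_nonneg_right h2 (by positivity)
    have g4 : 2048 * (k * x) ^ 2 ≤ (k * x) * (k * x) ^ 2 := by
      exact mul_le_mul_of_nonneg_right h2 (by positivity)
    have g5 : 0 ≤ ((k : ℝ) * x) ^ 4 := by positivity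
    nlinarith

end L2Closeness

/-- The closeness tester: a majority vote of independent `ℓ₂`-closeness tests. -/
def closenessTester (N : ℕ) (b ε δ : ℝ) : SampleProg Bool (Fin N) Bool :=
  if 1 ≤ N * b then
    ((l2ClosenessTester N b ε).repeated (repetitions δ)).bind fun l =>
      ret (decide (l.length < 2 * l.count true))
  else ret true

theorem majority_eq {l : List Bool} {c : Bool} {bad : Bool → Bool}
    (hbad : ∀ x, bad x = false → x = c) (h : 2 * l.countP bad < l.length) :
    decide (l.length < 2 * l.count true) = c := by
  have h1 : l.count (!c) ≤ l.countP bad := List.countP_mono_left fun x _ hx => by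
    by_contra h
    have := hbad x (by simpa using h)
    cases c <;> simp_all
  have h2 := l.count_true_add_count_false
  cases c
  · simp only [Bool.not_false, decide_eq_false_iff_not] at h1 ⊢
    omega
  · simp only [Bool.not_true, decide_eq_true_eq] at h1 ⊢
    omega

theorem one_sub_le_closenessTester {N : ℕ} {b ε δ : ℝ} (hδ : 0 < δ) (hN : 1 ≤ N * b)
    (p : Bool → PMF (Fin N)) (c : Bool)
    (h : ((l2ClosenessTester N b ε).run p).prob {c}ᶜ ≤ ENNReal.ofReal (1 / 16)) :
    1 - δ ≤ (((closenessTester N b ε δ).run p) c).toReal := by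
  rw [← PMF.toOuterMeasure_apply_singleton]
  refine PMF.one_sub_le_prob_of_prob_compl_le hδ.le ?_
  rw [closenessTester, if_pos hN, run_bind, ← add_zero (ENNReal.ofReal δ)]
  refine (PMF.prob_bind_le _ _ _ _ 0 fun l hl => ?_).trans (add_le_add_left
    (prob_repeated_majority_le _ _ _ h hδ) 0)
  rw [run_ret, PMF.prob_pure, if_neg]
  rw [Set.notMem_compl_iff, Set.mem_singleton_iff]
  rw [Set.mem_ofPred_eq, not_le] at hl
  exact majority_eq (fun x hx => by simpa using hx) hl

theorem isClosenessTester_closenessTester : IsClosenessTester closenessTester := by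
  -- `12300 = 3 * (2 * 1025 * 2)`: repetitions, two groups of rounded size, two samples per pair.
  refine ⟨12300, by norm_num, fun N b ε δ hb hε hε' hδ hδ' => ⟨?_, fun p q hpq => ?_⟩⟩
  · have h1 := repetitions_le hδ hδ'
    have h0 := h1.trans' (Nat.cast_nonneg _)
    -- If `N * b < 1`, no pair of distributions meets the promise, as squared norms are at least `1
    -- / N`. The tester then draws nothing; otherwise `N * √b / ε ^ 2 ≥ 1` absorbs the ceiling.
    by_cases hN : 1 ≤ N * b
    · refine ⟨repetitions δ * (2 * closenessSize N b ε * 2), ?_, ?_⟩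
      · rw [closenessTester, if_pos hN, ← add_zero ((_ : ℕ) : ℕ∞)]
        refine maxSamples_bind_le _ _ (maxSamples_repeated_le _ ?_ _) fun _ => maxSamples_ret_le _ _
        rw [← add_zero ((_ : ℕ) : ℕ∞)]
        exact maxSamples_bind_le _ _ (maxSamples_bilinearStat_le _ _ _
          maxSamples_samplePair_le) fun _ => maxSamples_ret_le _ _
      · have hNb : 1 ≤ N * √b / ε ^ 2 := by
          have hN1 : (1 : ℝ) ≤ N := by
            have : N ≠ 0 := by rintro rfl; norm_num at hN
            exact_mod_cast Nat.one_le_iff_ne_zero.2 this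
          rw [le_div_iff₀ (by positivity), one_mul]
          have h3 : 1 ≤ √(N * b) := Real.one_le_sqrt.2 hN
          have h4 : √(N * b) ≤ N * √b := by
            rw [Real.sqrt_mul (by positivity)]
            gcongr
            exact Real.sqrt_le_iff.2 ⟨by positivity, by nlinarith⟩
          nlinarith
        have h2 : (closenessSize N b ε : ℝ) ≤ 1025 * (N * √b / ε ^ 2) := by
          have h4 : (closenessSize N b ε : ℝ) < 1024 * (N * √b / ε ^ 2) + 1 :=
            Nat.ceil_lt_add_one (by positivity)
          linarith
        push_cast
        calc (repetitions δ : ℝ) * (2 * closenessSize N b ε * 2)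
            ≤ 3 * Real.log (1 / δ) * (2 * (1025 * (N * √b / ε ^ 2)) * 2) := by gcongr
          _ = 12300 * (N * √b / ε ^ 2 * Real.log (1 / δ)) := by ring
    · refine ⟨0, ?_, ?_⟩
      · rw [closenessTester, if_neg hN]
        exact maxSamples_ret_le _ _
      · have : 0 ≤ Real.log (1 / δ) := by linarith
        rw [Nat.cast_zero]
        positivity
  · have hN : 1 ≤ N * b := by
      refine le_trans ?_ (mul_le_mul_of_nonneg_left hpq (Nat.cast_nonneg N))
      rcases min_choice (l2NormSq p) (l2NormSq q) with h | h <;> rw [h] <;>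
        exact one_le_card_mul_l2NormSq _
    exact ⟨fun h => one_sub_le_closenessTester hδ hN _ _ (prob_l2ClosenessTester_eq hb hε hN hpq h),
      fun h => one_sub_le_closenessTester hδ hN _ _ (prob_l2ClosenessTester_far hb hε hε' hN hpq h)⟩

end

open scoped ENNReal

noncomputable section

/-! ### Flattened distributions -/

namespace PMF

variable {X Y : Type}

theorem map_apply_of_injective {f : X → Y} (hf : Function.Injective f) (p : PMF X) (x : X) :
    p.map f (f x) = p x := by
  rw [PMF.map_apply, tsum_eq_single x]
  · simp
  · intro y hy
    rw [if_neg fun h => hy (hf h.symm)]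

theorem map_fst_prodLaw (p : PMF X) (q : PMF Y) : (p.prodLaw q).map Prod.fst = p := by
  simp [prodLaw, PMF.map_bind, PMF.pure_map, PMF.bind_const, PMF.bind_pure]

theorem map_snd_prodLaw (p : PMF X) (q : PMF Y) : (p.prodLaw q).map Prod.snd = q := by
  simp [prodLaw, PMF.map_bind, PMF.pure_map, PMF.bind_const, PMF.bind_pure]

end PMF

/-- The factors of a product are its marginals, so comparing with the product of the marginals is
exact in the product case. -/
theorem isProductDist_iff {n m : ℕ} (p : PMF (Fin n × Fin m)) :
    IsProductDist p ↔ p = (p.map Prod.fst).prodLaw (p.map Prod.snd) := by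
  constructor
  · rintro ⟨q, r, h⟩
    have : p = q.prodLaw r := by
      ext ⟨i, j⟩
      rw [h, PMF.prodLaw_apply]
    rw [this, PMF.map_fst_prodLaw, PMF.map_snd_prodLaw]
  · intro h
    exact ⟨p.map Prod.fst, p.map Prod.snd, fun i j => by
      conv_lhs => rw [h]
      rw [PMF.prodLaw_apply]⟩

section Invariance

variable {X Y : Type} [Fintype X] [Fintype Y]

theorem l2NormSq_map_equiv (e : X ≃ Y) (p : PMF X) : l2NormSq (p.map e) = l2NormSq p := by
  unfold l2NormSq
  rw [← e.sum_comp]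
  simp only [PMF.map_apply_of_injective e.injective]

theorem tvDist_map_equiv (e : X ≃ Y) (p q : PMF X) : tvDist (p.map e) (q.map e) = tvDist p q := by
  unfold tvDist
  rw [← e.sum_comp]
  simp only [PMF.map_apply_of_injective e.injective]

theorem l2NormSq_prodLaw (p : PMF X) (q : PMF Y) :
    l2NormSq (p.prodLaw q) = l2NormSq p * l2NormSq q := by
  simp only [l2NormSq, Fintype.sum_prod_type, PMF.prodLaw_apply, ENNReal.toReal_mul, mul_pow,
    Finset.sum_mul_sum]

end Invariance

section Flatten

theorem sum_buckets {n : ℕ} (b₁ : Fin n → ℕ) (f : Fin (∑ i, b₁ i) → ℝ) :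
    ∑ u, f u = ∑ i, ∑ k : Fin (b₁ i), f (finSigmaFinEquiv ⟨i, k⟩) := by
  rw [← finSigmaFinEquiv.sum_comp, Fintype.sum_sigma]

variable {n m : ℕ} (b₁ : Fin n → ℕ) (b₂ : Fin m → ℕ) [∀ i, NeZero (b₁ i)] [∀ j, NeZero (b₂ j)]

/-- The uniform distribution on the buckets of `i`. -/
def bucketLaw (i : Fin n) : PMF (Fin (∑ i, b₁ i)) :=
  (PMF.uniformOfFintype (Fin (b₁ i))).map fun k => finSigmaFinEquiv ⟨i, k⟩

theorem bucketLaw_apply (i i' : Fin n) (k : Fin (b₁ i')) :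
    bucketLaw b₁ i (finSigmaFinEquiv ⟨i', k⟩) = if i = i' then (b₁ i' : ℝ≥0∞)⁻¹ else 0 := by
  unfold bucketLaw
  split_ifs with h
  · subst h
    have hinj : Function.Injective fun k : Fin (b₁ i) => finSigmaFinEquiv (⟨i, k⟩ : Σ i, Fin (b₁ i)) :=
      fun k k' hk => by simpa using hk
    exact (PMF.map_apply_of_injective hinj _ k).trans (by simp)
  · rw [PMF.map_apply]
    simp only [ENNReal.tsum_eq_zero, ite_eq_right_iff]
    intro k' hk'
    exact absurd (congrArg Sigma.fst (finSigmaFinEquiv.injective hk')).symm h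

/-- The flattening of a distribution on `[n]`. -/
def flattenLaw (p : PMF (Fin n)) : PMF (Fin (∑ i, b₁ i)) := p.bind (bucketLaw b₁)

theorem flattenLaw_apply (p : PMF (Fin n)) (i : Fin n) (k : Fin (b₁ i)) :
    flattenLaw b₁ p (finSigmaFinEquiv ⟨i, k⟩) = p i * (b₁ i : ℝ≥0∞)⁻¹ := by
  simp only [flattenLaw, PMF.bind_apply, bucketLaw_apply, tsum_fintype, mul_ite, mul_zero,
    Finset.sum_ite_eq', Finset.mem_univ, if_true]

/-- Each of the `b₁ i` buckets carries mass `p i / b₁ i`. -/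
theorem l2NormSq_flattenLaw (p : PMF (Fin n)) :
    l2NormSq (flattenLaw b₁ p) = ∑ i, (p i).toReal ^ 2 / b₁ i := by
  rw [l2NormSq, sum_buckets]
  refine Finset.sum_congr rfl fun i _ => ?_
  have : (b₁ i : ℝ) ≠ 0 := by exact_mod_cast NeZero.ne (b₁ i)
  simp only [flattenLaw_apply, ENNReal.toReal_mul, ENNReal.toReal_inv, ENNReal.toReal_natCast,
    Finset.sum_const, Finset.card_univ, Fintype.card_fin, nsmul_eq_mul]
  field_simp

/-- The flattening of a distribution on `[n] × [m]`. -/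
def flattenLaw₂ (p : PMF (Fin n × Fin m)) : PMF (Fin (∑ i, b₁ i) × Fin (∑ j, b₂ j)) :=
  p.bind fun x => (bucketLaw b₁ x.1).prodLaw (bucketLaw b₂ x.2)

theorem flattenLaw₂_apply (p : PMF (Fin n × Fin m)) (i : Fin n) (k : Fin (b₁ i)) (j : Fin m)
    (l : Fin (b₂ j)) :
    flattenLaw₂ b₁ b₂ p (finSigmaFinEquiv ⟨i, k⟩, finSigmaFinEquiv ⟨j, l⟩)
      = p (i, j) * ((b₁ i : ℝ≥0∞)⁻¹ * (b₂ j : ℝ≥0∞)⁻¹) := by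
  simp only [flattenLaw₂, PMF.bind_apply, PMF.prodLaw_apply, bucketLaw_apply, tsum_fintype,
    Fintype.sum_prod_type]
  rw [Finset.sum_eq_single i, Finset.sum_eq_single j]
  · simp
  · intro j' _ hj'
    simp [hj']
  · simp
  · intro i' _ hi'
    simp [hi']
  · simp

theorem flattenLaw₂_prodLaw (p : PMF (Fin n)) (q : PMF (Fin m)) :
    flattenLaw₂ b₁ b₂ (p.prodLaw q) = (flattenLaw b₁ p).prodLaw (flattenLaw b₂ q) := by
  ext ⟨u, v⟩
  obtain ⟨⟨i, k⟩, rfl⟩ := finSigmaFinEquiv.surjective u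
  obtain ⟨⟨j, l⟩, rfl⟩ := finSigmaFinEquiv.surjective v
  rw [flattenLaw₂_apply, PMF.prodLaw_apply, PMF.prodLaw_apply, flattenLaw_apply, flattenLaw_apply]
  ring

/-- The buckets depend only on the point, so the difference at `(i, j)` is spread evenly, with
constant sign, over its `b₁ i * b₂ j` cells. -/
theorem tvDist_flattenLaw₂ (p q : PMF (Fin n × Fin m)) :
    tvDist (flattenLaw₂ b₁ b₂ p) (flattenLaw₂ b₁ b₂ q) = tvDist p q := by
  unfold tvDist
  congr 1
  rw [Fintype.sum_prod_type, Fintype.sum_prod_type, sum_buckets]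
  refine Finset.sum_congr rfl fun i _ => ?_
  have hi : (b₁ i : ℝ) ≠ 0 := by exact_mod_cast NeZero.ne (b₁ i)
  simp only [sum_buckets b₂, flattenLaw₂_apply, ENNReal.toReal_mul, ENNReal.toReal_inv,
    ENNReal.toReal_natCast, Finset.sum_const, Finset.card_univ, Fintype.card_fin, nsmul_eq_mul,
    ← sub_mul, abs_mul]
  rw [Finset.mul_sum]
  refine Finset.sum_congr rfl fun j _ => ?_
  have hj : (b₂ j : ℝ) ≠ 0 := by exact_mod_cast NeZero.ne (b₂ j)
  rw [abs_of_nonneg (by positivity : (0 : ℝ) ≤ (b₁ i : ℝ)⁻¹),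
    abs_of_nonneg (by positivity : (0 : ℝ) ≤ (b₂ j : ℝ)⁻¹)]
  field_simp

open SampleProg

variable (p : PMF (Fin n × Fin m))

theorem run_flattenPoint {ι X : Type} (q : ι → PMF X) (i : Fin n) :
    (flattenPoint b₁ i).run q = bucketLaw b₁ i := by
  simp only [flattenPoint, monad_bind_eq_bind, pure_eq_ret, run_bind, run_random, run_ret]
  rfl

theorem run_flatSample₁ :
    (flatSample₁ b₁ : SampleProg Unit (Fin n × Fin m) _).run (fun _ => p)
      = flattenLaw b₁ (p.map Prod.fst) := by
  simp only [flatSample₁, monad_bind_eq_bind, run_bind, run_sample, run_flattenPoint, flattenLaw,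
    PMF.bind_map]
  rfl

theorem run_flatSample₂ :
    (flatSample₂ b₂ : SampleProg Unit (Fin n × Fin m) _).run (fun _ => p)
      = flattenLaw b₂ (p.map Prod.snd) := by
  simp only [flatSample₂, monad_bind_eq_bind, run_bind, run_sample, run_flattenPoint, flattenLaw,
    PMF.bind_map]
  rfl

theorem run_flatSampleJoint :
    (flatSampleJoint b₁ b₂).run (fun _ => p) = (flattenLaw₂ b₁ b₂ p).map finProdFinEquiv := by
  simp only [flatSampleJoint, monad_bind_eq_bind, pure_eq_ret, run_bind, run_sample, run_ret,
    run_flattenPoint, flattenLaw₂, PMF.prodLaw, PMF.map_bind, PMF.pure_map]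

theorem run_flatSampleProd :
    (flatSampleProd b₁ b₂).run (fun _ => p)
      = ((flattenLaw b₁ (p.map Prod.fst)).prodLaw (flattenLaw b₂ (p.map Prod.snd))).map
          finProdFinEquiv := by
  simp only [flatSampleProd, monad_bind_eq_bind, pure_eq_ret, run_bind, run_ret,
    run_flatSample₁, run_flatSample₂, PMF.prodLaw, PMF.map_bind, PMF.pure_map]

theorem maxSamples_flattenPoint_le {ι X : Type} (i : Fin n) :
    (flattenPoint b₁ i : SampleProg ι X _).maxSamples ≤ 0 :=
  (maxSamples_bind_le _ _ (maxSamples_random_le _ 0) fun _ => maxSamples_ret_le _ 0).trans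
    (by norm_num)

theorem maxSamples_flatSample₁_le :
    (flatSample₁ b₁ : SampleProg Unit (Fin n × Fin m) _).maxSamples ≤ 1 :=
  (maxSamples_bind_le _ _ (maxSamples_sample_le _) fun _ => maxSamples_flattenPoint_le _ _).trans
    (by norm_num)

theorem maxSamples_flatSample₂_le :
    (flatSample₂ b₂ : SampleProg Unit (Fin n × Fin m) _).maxSamples ≤ 1 :=
  (maxSamples_bind_le _ _ (maxSamples_sample_le _) fun _ => maxSamples_flattenPoint_le _ _).trans
    (by norm_num)

theorem maxSamples_flatSampleJoint_le : (flatSampleJoint b₁ b₂).maxSamples ≤ 1 :=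
  (maxSamples_bind_le _ _ (maxSamples_sample_le _) fun _ => maxSamples_bind_le _ _
    (maxSamples_flattenPoint_le _ _) fun _ => maxSamples_bind_le _ _
    (maxSamples_flattenPoint_le _ _) fun _ => maxSamples_ret_le _ 0).trans (by norm_num)

theorem maxSamples_flatSampleProd_le : (flatSampleProd b₁ b₂).maxSamples ≤ 2 :=
  (maxSamples_bind_le _ _ (maxSamples_flatSample₁_le _) fun _ => maxSamples_bind_le _ _
    (maxSamples_flatSample₂_le _) fun _ => maxSamples_ret_le _ 0).trans (by norm_num)

end Flatten

end

/-! ### Expected norm after flattening with Poisson many samples -/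

open scoped ENNReal

noncomputable section

/-! ### Poisson distributions -/

theorem poisson_apply {s : ℝ} (hs : 0 ≤ s) (t : ℕ) :
    poisson s t = ENNReal.ofReal (Real.exp (-s) * s ^ t / t.factorial) := by
  rw [poisson, MeasureTheory.Measure.toPMF_apply, ProbabilityTheory.poissonMeasure_singleton,
    Real.coe_toNNReal s hs]

/-- The size-bias identity of the Poisson law, which yields both its mean and the bound on the
expectation of `1 / (t + 1)`. -/
theorem poisson_succ_mul {s : ℝ} (hs : 0 ≤ s) (t : ℕ) :
    poisson s (t + 1) * (t + 1 : ℝ≥0∞) = ENNReal.ofReal s * poisson s t := by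
  have : (t + 1 : ℝ≥0∞) = ENNReal.ofReal (t + 1) := by
    rw [ENNReal.ofReal_add (by positivity) (by norm_num), ENNReal.ofReal_natCast, ENNReal.ofReal_one]
  rw [this, poisson_apply hs, poisson_apply hs, ← ENNReal.ofReal_mul (by positivity),
    ← ENNReal.ofReal_mul hs, Nat.factorial_succ]
  congr 1
  push_cast
  field_simp
  ring

theorem lexp_poisson_natCast {s : ℝ} (hs : 0 ≤ s) :
    ((poisson s).lexp fun t => (t : ℝ≥0∞)) = ENNReal.ofReal s := by
  unfold PMF.lexp
  rw [tsum_eq_zero_add' ENNReal.summable]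
  simp only [Nat.cast_zero, mul_zero, Nat.cast_add, Nat.cast_one, zero_add, poisson_succ_mul hs,
    ENNReal.tsum_mul_left, PMF.tsum_coe, mul_one]

theorem mul_lexp_poisson_inv_le {s : ℝ} (hs : 0 ≤ s) :
    ENNReal.ofReal s * ((poisson s).lexp fun t => (t + 1 : ℝ≥0∞)⁻¹) ≤ 1 := by
  rw [← PMF.lexp_const_mul]
  calc ((poisson s).lexp fun t => ENNReal.ofReal s * (t + 1 : ℝ≥0∞)⁻¹)
      = ∑' t, poisson s (t + 1) := by
        refine tsum_congr fun t => ?_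
        rw [mul_left_comm, ← mul_assoc, ← poisson_succ_mul hs, mul_assoc, ENNReal.mul_inv_cancel,
          mul_one]
        · simp
        · exact_mod_cast ENNReal.natCast_ne_top (t + 1)
    _ ≤ ∑' t, poisson s t := ENNReal.tsum_comp_le_tsum_of_injective (add_left_injective 1) _
    _ = 1 := (poisson s).tsum_coe

theorem prob_poisson_gt_le {s : ℝ} (hs : 0 ≤ s) :
    (poisson s).prob {t : ℕ | (t : ℝ) > 160 * s} ≤ ENNReal.ofReal (1 / 160) := by
  -- At rate 0 the threshold is 0 and cannot be divided out; there a positive count is at least 1,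
  -- while the mean is 0.
  rcases hs.eq_or_lt with rfl | hpos
  · have h := (poisson 0).prob_mul_le_lexp (S := {t : ℕ | (t : ℝ) > 160 * 0})
      (f := fun t => (t : ℝ≥0∞)) (c := 1) fun t ht => by
        have : 0 < t := by simpa using ht
        exact_mod_cast this
    rw [lexp_poisson_natCast le_rfl, one_mul, ENNReal.ofReal_zero] at h
    exact h.trans zero_le
  · have h := (poisson s).prob_mul_le_lexp (S := {t : ℕ | (t : ℝ) > 160 * s})
      (f := fun t => (t : ℝ≥0∞)) (c := ENNReal.ofReal (160 * s)) fun t ht => by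
        rw [← ENNReal.ofReal_natCast]
        exact ENNReal.ofReal_le_ofReal (le_of_lt ht)
    rw [lexp_poisson_natCast hs, mul_comm] at h
    refine (ENNReal.le_div_iff_mul_le (Or.inl (by simpa using hpos)) (Or.inl ENNReal.ofReal_ne_top)
      |>.2 h).trans (le_of_eq ?_)
    rw [← ENNReal.ofReal_div_of_pos (by positivity)]
    congr 1
    field_simp

/-! ### Frequencies in independent samples -/

namespace PMF

theorem lexp_iidList_map {Ω Ω₂ : Type} (μ : PMF Ω₂) (g : Ω₂ → Ω) (t : ℕ) (f : List Ω → ℝ≥0∞) :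
    ((μ.iidList t).lexp fun l => f (l.map g)) = ((μ.map g).iidList t).lexp f := by
  induction t generalizing f with
  | zero => simp [lexp_iidList_zero]
  | succ t ih =>
    rw [lexp_iidList_succ, lexp_iidList_succ]
    have h : ∀ F : Ω → ℝ≥0∞, (μ.map g).lexp F = μ.lexp fun x => F (g x) := fun F => by
      simp only [PMF.map, lexp_bind, Function.comp_apply, lexp_pure]
    rw [h]
    exact congrArg μ.lexp (funext fun x => ih fun l => f (g x :: l))

variable {Ω : Type} [DecidableEq Ω]

theorem lexp_count_succ (μ : PMF Ω) (a : Ω) (t : ℕ) (f : ℕ → ℝ≥0∞) :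
    ((μ.iidList (t + 1)).lexp fun l => f (l.count a))
      = μ a * ((μ.iidList t).lexp fun l => f (l.count a + 1))
        + μ.prob {a}ᶜ * ((μ.iidList t).lexp fun l => f (l.count a)) := by
  rw [lexp_iidList_succ, ← prob_singleton, prob_eq_lexp, prob_eq_lexp, ← lexp_mul_const,
    ← lexp_mul_const, ← lexp_add]
  congr 1
  ext x
  by_cases hx : x = a
  · simp [hx]
  · simp [hx]

/-- The size-bias identity for the frequency of `a`. -/
theorem lexp_count_mul (μ : PMF Ω) (a : Ω) (t : ℕ) (f : ℕ → ℝ≥0∞) :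
    ((μ.iidList (t + 1)).lexp fun l => l.count a * f (l.count a - 1))
      = (t + 1) * μ a * (μ.iidList t).lexp fun l => f (l.count a) := by
  have hstep : ∀ t : ℕ, ((μ.iidList (t + 1)).lexp fun l => l.count a * f (l.count a - 1))
      = μ a * ((μ.iidList t).lexp fun l => (l.count a + 1 : ℝ≥0∞) * f (l.count a))
        + μ.prob {a}ᶜ * ((μ.iidList t).lexp fun l => l.count a * f (l.count a - 1)) := fun t => by
    simpa using μ.lexp_count_succ a t fun k => k * f (k - 1)
  induction t generalizing f with
  | zero => rw [hstep]; simp [lexp_iidList_zero]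
  | succ t ih =>
    have h1 : ∀ l : List Ω, (l.count a + 1 : ℝ≥0∞) * f (l.count a)
        = l.count a * (fun k => f (k + 1)) (l.count a - 1) + f (l.count a) := fun l => by
      rcases Nat.eq_zero_or_pos (l.count a) with h | h
      · simp [h]
      · simp only [Nat.sub_add_cancel h, add_mul, one_mul]
    -- The recursion `hstep` depends on `f` and was generalized along with it, so the induction
    -- hypothesis asks for it again.
    have ih' := fun f => ih f fun t => by simpa using μ.lexp_count_succ a t fun k => k * f (k - 1)
    rw [hstep, ih' f]
    simp only [h1, lexp_add]
    rw [ih' fun k => f (k + 1), μ.lexp_count_succ a t f]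
    push_cast
    ring

/-- The size-bias identity with `f k = 1 / (k + 1)` turns the left side into the mean of `N / N`,
which is at most 1 and vanishes where `N = 0`. -/
theorem mul_lexp_inv_count_le (μ : PMF Ω) (a : Ω) (t : ℕ) :
    (t + 1) * μ a * ((μ.iidList t).lexp fun l => (l.count a + 1 : ℝ≥0∞)⁻¹) ≤ 1 := by
  have h := μ.lexp_count_mul a t fun k => (k + 1 : ℝ≥0∞)⁻¹
  rw [← h]
  refine lexp_le_of_le _ fun l => ?_
  rcases Nat.eq_zero_or_pos (l.count a) with h | h
  · simp [h]
  · have h2 : ((l.count a - 1 : ℕ) + 1 : ℝ≥0∞) = l.count a := by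
      exact_mod_cast congrArg (Nat.cast (R := ℝ≥0∞)) (Nat.sub_add_cancel h)
    rw [h2]
    exact ENNReal.mul_inv_le_one _

/-- The expectation of `1 / (N + 1)`, where `N` is the frequency of `a` among Poisson many samples. -/
theorem mul_lexp_poisson_inv_count_le (μ : PMF Ω) (a : Ω) {s : ℝ} (hs : 0 ≤ s) :
    ENNReal.ofReal s * μ a * ((poisson s).lexp fun t =>
      (μ.iidList t).lexp fun l => (l.count a + 1 : ℝ≥0∞)⁻¹) ≤ 1 := by
  -- For fixed `t` the inner mean is at most `1 / ((t + 1) * μ a)`. Averaging `1 / (t + 1)` over `t`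
  -- then suffices, and the law of the count under Poisson sampling is not needed.
  refine le_trans ?_ (mul_lexp_poisson_inv_le hs)
  rw [mul_assoc, ← lexp_const_mul]
  gcongr
  refine lexp_mono _ fun t => ?_
  have h := μ.mul_lexp_inv_count_le a t
  rw [ENNReal.le_inv_iff_mul_le]
  refine le_trans (le_of_eq ?_) h
  ring

end PMF

/-! ### The expected norm of the flattened distribution -/

theorem tvDist_map_le {X Y : Type} [Fintype X] [Fintype Y] (f : X → Y) (p q : PMF X) :
    tvDist (p.map f) (q.map f) ≤ tvDist p q := by
  classical
  have h : ∀ (r : PMF X) (y : Y), (r.map f y).toReal = ∑ x, if y = f x then (r x).toReal else 0 :=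
    fun r y => by
      rw [PMF.map_apply, tsum_fintype, ENNReal.toReal_sum]
      · exact Finset.sum_congr rfl fun x _ => by split_ifs <;> simp
      · intro x _
        split_ifs
        · exact r.apply_ne_top x
        · simp
  unfold tvDist
  gcongr
  calc ∑ y, |(p.map f y).toReal - (q.map f y).toReal|
      ≤ ∑ y, ∑ x, if y = f x then |(p x).toReal - (q x).toReal| else 0 := by
        refine Finset.sum_le_sum fun y _ => ?_
        rw [h, h, ← Finset.sum_sub_distrib]
        refine (Finset.abs_sum_le_sum_abs _ _).trans (Finset.sum_le_sum fun x _ => ?_)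
        split_ifs <;> simp
    _ = ∑ x, |(p x).toReal - (q x).toReal| := by
        rw [Finset.sum_comm]
        simp

theorem sum_posPart_eq_tvDist {X : Type} [Fintype X] (p q : PMF X) :
    ∑ x, max ((p x).toReal - (q x).toReal) 0 = tvDist p q := by
  have h : ∀ x, max ((p x).toReal - (q x).toReal) 0
      = 1 / 2 * |(p x).toReal - (q x).toReal| + 1 / 2 * ((p x).toReal - (q x).toReal) := fun x => by
    rcases le_total 0 ((p x).toReal - (q x).toReal) with h | h
    · rw [max_eq_left h, abs_of_nonneg h]; ring
    · rw [max_eq_right h, abs_of_nonpos h]; ring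
  simp only [h, Finset.sum_add_distrib, ← Finset.mul_sum, Finset.sum_sub_distrib,
    PMF.toReal_sum_eq_one, sub_self, mul_zero, add_zero, tvDist]

section ExpectedNorm

variable {n : ℕ} (p q : PMF (Fin n))

/-- If `p i ≤ 2 * q i`, the predicted buckets alone number at least `n * q i ≥ n * p i / 2`.
Otherwise only the sampled ones are used: the mean is at most `p i / s`, and `p i < 2 * (p i - q
i)`. With an exact prediction the second case is impossible, so `s = 0` does no harm. -/
theorem lexp_sq_div_buckets_le (hn : 0 < n) {s : ℝ} (hs : 0 < s ∨ p = q ∧ 0 ≤ s) (i : Fin n) :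
    ((poisson s).lexp fun t => (p.iidList t).lexp fun l =>
        ENNReal.ofReal ((p i).toReal ^ 2 / buckets q l i))
      ≤ ENNReal.ofReal (2 / n * (p i).toReal + 2 / s * max ((p i).toReal - (q i).toReal) 0) := by
  have hn' : (0 : ℝ) < n := by exact_mod_cast hn
  have hs0 : 0 ≤ s := by rcases hs with h | h; exacts [h.le, h.2]
  have hp0 : 0 ≤ (p i).toReal := ENNReal.toReal_nonneg
  have hq0 : 0 ≤ (q i).toReal := ENNReal.toReal_nonneg
  have hb : ∀ l, (buckets q l i : ℝ) = ⌊(n : ℝ) * (q i).toReal⌋₊ + l.count i + 1 := fun l => by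
    simp [buckets]
  by_cases hpq : (p i).toReal ≤ 2 * (q i).toReal
  · refine PMF.lexp_le_of_le _ fun t => PMF.lexp_le_of_le _ fun l => ENNReal.ofReal_le_ofReal ?_
    refine le_trans ?_ (le_add_of_nonneg_right (by positivity))
    have h1 : (n : ℝ) * (q i).toReal ≤ buckets q l i := by
      rw [hb]
      have := Nat.lt_floor_add_one ((n : ℝ) * (q i).toReal)
      have : (0 : ℝ) ≤ l.count i := by positivity
      linarith
    have h2 : (0 : ℝ) < buckets q l i := by rw [hb]; positivity
    rw [div_mul_eq_mul_div, div_le_div_iff₀ h2 hn']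
    have h3 : (p i).toReal * n ≤ 2 * buckets q l i := by nlinarith
    nlinarith
  · have hspos : 0 < s := by
      rcases hs with h | ⟨rfl, _⟩
      · exact h
      · exact absurd (by linarith) hpq
    push Not at hpq
    have hppos : 0 < (p i).toReal := by linarith
    calc ((poisson s).lexp fun t => (p.iidList t).lexp fun l =>
          ENNReal.ofReal ((p i).toReal ^ 2 / buckets q l i))
        ≤ (poisson s).lexp fun t => (p.iidList t).lexp fun l =>
          ENNReal.ofReal ((p i).toReal / s) * (ENNReal.ofReal s * p i)
            * (l.count i + 1 : ℝ≥0∞)⁻¹ := by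
          refine PMF.lexp_mono _ fun t => PMF.lexp_mono _ fun l => ?_
          have e1 : (l.count i + 1 : ℝ≥0∞)⁻¹ = ENNReal.ofReal ((l.count i + 1 : ℝ)⁻¹) := by
            rw [ENNReal.ofReal_inv_of_pos (by positivity),
              ENNReal.ofReal_add (by positivity) (by norm_num), ENNReal.ofReal_natCast,
              ENNReal.ofReal_one]
          rw [e1, ← ENNReal.ofReal_toReal (p.apply_ne_top i), ← ENNReal.ofReal_mul hs0,
            ← ENNReal.ofReal_mul (by positivity), ← ENNReal.ofReal_mul (by positivity)]
          refine ENNReal.ofReal_le_ofReal ?_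
          rw [ENNReal.toReal_ofReal hp0]
          have e2 : (p i).toReal / s * (s * (p i).toReal) = (p i).toReal ^ 2 := by
            field_simp
          rw [e2, ← div_eq_mul_inv]
          refine div_le_div_of_nonneg_left (by positivity) (by positivity) ?_
          rw [hb]
          have : (0 : ℝ) ≤ ⌊(n : ℝ) * (q i).toReal⌋₊ := by positivity
          linarith
      _ ≤ ENNReal.ofReal ((p i).toReal / s) := by
          simp only [PMF.lexp_const_mul]
          rw [mul_assoc]
          exact mul_le_of_le_one_right' (p.mul_lexp_poisson_inv_count_le i hs0)
      _ ≤ _ := by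
          refine ENNReal.ofReal_le_ofReal ?_
          refine le_trans ?_ (le_add_of_nonneg_left (by positivity))
          rw [div_mul_eq_mul_div]
          gcongr
          have := le_max_left ((p i).toReal - (q i).toReal) 0
          linarith

/-- If the prediction `q` is `α`-close to `p`, then the expected squared norm of the flattened
distribution is at most `2 α / s + 4 / n`. -/
theorem lexp_l2NormSq_flattenLaw_le (hn : 0 < n) {s α : ℝ} (hs : 0 < s ∨ α = 0 ∧ s = 0)
    (hα : tvDist p q ≤ α) :
    ((poisson s).lexp fun t => (p.iidList t).lexp fun l =>
        ENNReal.ofReal (l2NormSq (flattenLaw (buckets q l) p)))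
      ≤ ENNReal.ofReal (2 * α / s + 4 / n) := by
  have hn' : (0 : ℝ) < n := by exact_mod_cast hn
  have hs' : 0 < s ∨ p = q ∧ 0 ≤ s := by
    refine hs.imp_right fun h => ⟨?_, h.2.ge⟩
    rw [h.1, tvDist] at hα
    have h0 : ∑ x, |(p x).toReal - (q x).toReal| ≤ 0 := by linarith
    have h1 := (Finset.sum_eq_zero_iff_of_nonneg fun x _ => abs_nonneg _).1
      (le_antisymm h0 (Finset.sum_nonneg fun x _ => abs_nonneg _))
    ext x
    have h2 := sub_eq_zero.1 (abs_eq_zero.1 (h1 x (Finset.mem_univ x)))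
    exact (ENNReal.toReal_eq_toReal_iff' (p.apply_ne_top x) (q.apply_ne_top x)).1 h2
  have hs0 : 0 ≤ s := by rcases hs with h | h; exacts [h.le, h.2.ge]
  have hsum : ∀ l, ENNReal.ofReal (l2NormSq (flattenLaw (buckets q l) p))
      = ∑ i, ENNReal.ofReal ((p i).toReal ^ 2 / buckets q l i) := fun l => by
    rw [l2NormSq_flattenLaw, ENNReal.ofReal_sum_of_nonneg fun i _ => by positivity]
  simp only [hsum, PMF.lexp_finset_sum]
  refine (Finset.sum_le_sum fun i _ => lexp_sq_div_buckets_le p q hn hs' i).trans ?_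
  rw [← ENNReal.ofReal_sum_of_nonneg fun i _ => by positivity]
  refine ENNReal.ofReal_le_ofReal ?_
  rw [Finset.sum_add_distrib, ← Finset.mul_sum, ← Finset.mul_sum, sum_posPart_eq_tvDist,
    PMF.toReal_sum_eq_one]
  have h1 : 2 / s * tvDist p q ≤ 2 * α / s := by
    rw [div_mul_eq_mul_div]
    gcongr
  have h2 : 2 / (n : ℝ) * 1 ≤ 4 / n := by
    rw [mul_one]
    gcongr
    norm_num
  linarith

end ExpectedNorm

end

open scoped ENNReal

noncomputable section

open SampleProg

/-! ### Error probabilities for a fixed flattening -/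

/-- The estimates of `E` with failure probability `1 / 120` are correct. -/
def NormEstimatesCorrect (E : (N : ℕ) → (δ : ℝ) → SampleProg Unit (Fin N) ℝ) : Prop :=
  ∀ (N : ℕ) (p : PMF (Fin N)), ((E N (1 / 120)).run fun _ => p).prob
    {L | l2NormSq p / 2 ≤ L ∧ L ≤ 3 * l2NormSq p / 2}ᶜ ≤ ENNReal.ofReal (1 / 120)

/-- The answers of `T` with failure probability `1 / 80` are correct. -/
def ClosenessTestsCorrect (T : (N : ℕ) → (b ε δ : ℝ) → SampleProg Bool (Fin N) Bool) : Prop :=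
  ∀ (N : ℕ) (b ε : ℝ), 0 < b → 0 < ε → ε < 1 → ∀ p q : PMF (Fin N),
    min (l2NormSq p) (l2NormSq q) ≤ b →
    (p = q →
      ((T N b ε (1 / 80)).run fun i => bif i then q else p).prob {true}ᶜ
        ≤ ENNReal.ofReal (1 / 80)) ∧
    (ε ≤ tvDist p q →
      ((T N b ε (1 / 80)).run fun i => bif i then q else p).prob {false}ᶜ
        ≤ ENNReal.ofReal (1 / 80))

section FlattenedTest

variable (E : (N : ℕ) → (δ : ℝ) → SampleProg Unit (Fin N) ℝ)
  (T : (N : ℕ) → (b ε δ : ℝ) → SampleProg Bool (Fin N) Bool)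
  {n m : ℕ} (b₁ : Fin n → ℕ) (b₂ : Fin m → ℕ) [∀ i, NeZero (b₁ i)] [∀ j, NeZero (b₂ j)]
  (τ₁ τ₂ ε : ℝ)

/-- The part of the test that follows the two checks of the marginals. -/
def flattenedJointTest : SampleProg Unit (Fin n × Fin m) Verdict :=
  (simulate (fun _ => flatSampleJoint b₁ b₂)
    (E ((∑ i, b₁ i) * ∑ j, b₂ j) (1 / 120))).bind fun L =>
  if L > 10 * 120 ^ 2 * τ₁ * τ₂ then ret Verdict.reject
  else (simulate (fun i => bif i then flatSampleProd b₁ b₂ else flatSampleJoint b₁ b₂)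
      (T ((∑ i, b₁ i) * ∑ j, b₂ j) (4 * 120 ^ 2 * τ₁ * τ₂) ε (1 / 80))).bind fun closeEnough =>
    ret (bif closeEnough then Verdict.accept else Verdict.reject)

theorem flattenedTest_eq : flattenedTest E T b₁ b₂ τ₁ τ₂ ε =
    (simulate (fun _ => flatSample₁ b₁) (E (∑ i, b₁ i) (1 / 120))).bind fun L₁ =>
    (simulate (fun _ => flatSample₂ b₂) (E (∑ j, b₂ j) (1 / 120))).bind fun L₂ =>
    if L₁ > 120 * τ₁ ∨ L₂ > 120 * τ₂ then ret Verdict.inaccurate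
    else flattenedJointTest E T b₁ b₂ τ₁ τ₂ ε := rfl

variable {E T τ₁ τ₂ ε} (p : PMF (Fin n × Fin m))

/-- A correct estimate is at least half the norm, so a norm above `2 * 120 * τ` forces the verdict
`inaccurate` unless that single estimate fails. If both norms are below, only the joint stage
matters. -/
theorem prob_flattenedTest_le (hE : NormEstimatesCorrect E) {v : Verdict}
    (hv : v ≠ Verdict.inaccurate) {c : ℝ≥0∞}
    (hc : l2NormSq (flattenLaw b₁ (p.map Prod.fst)) ≤ 2 * 120 * τ₁ →
      l2NormSq (flattenLaw b₂ (p.map Prod.snd)) ≤ 2 * 120 * τ₂ →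
      ((flattenedJointTest E T b₁ b₂ τ₁ τ₂ ε).run fun _ => p).prob {v} ≤ c) :
    ((flattenedTest E T b₁ b₂ τ₁ τ₂ ε).run fun _ => p).prob {v} ≤ ENNReal.ofReal (1 / 120) + c := by
  rw [flattenedTest_eq, run_bind]
  simp only [run_bind, run_simulate, run_flatSample₁, run_flatSample₂]
  by_cases h1 : l2NormSq (flattenLaw b₁ (p.map Prod.fst)) ≤ 2 * 120 * τ₁
  · by_cases h2 : l2NormSq (flattenLaw b₂ (p.map Prod.snd)) ≤ 2 * 120 * τ₂
    · rw [PMF.prob_bind]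
      refine PMF.lexp_le_of_le _ fun L₁ => ?_
      rw [PMF.prob_bind]
      refine PMF.lexp_le_of_le _ fun L₂ => ?_
      split_ifs
      · rw [run_ret, PMF.prob_pure, if_neg (by simpa using hv.symm)]
        exact zero_le
      · exact (hc h1 h2).trans le_add_self
    · rw [PMF.prob_bind]
      refine PMF.lexp_le_of_le _ fun L₁ => ?_
      refine (PMF.prob_bind_le _ _ _ _ c fun L₂ hL₂ => ?_).trans (add_le_add_left (hE _ _) c)
      rw [Set.notMem_compl_iff, Set.mem_ofPred_eq] at hL₂
      rw [if_pos (Or.inr (by linarith [hL₂.1])), run_ret, PMF.prob_pure,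
        if_neg (by simpa using hv.symm)]
      exact zero_le
  · refine (PMF.prob_bind_le _ _ _ _ c fun L₁ hL₁ => ?_).trans (add_le_add_left (hE _ _) c)
    rw [Set.notMem_compl_iff, Set.mem_ofPred_eq] at hL₁
    rw [PMF.prob_bind]
    refine PMF.lexp_le_of_le _ fun L₂ => ?_
    rw [if_pos (Or.inl (by linarith [hL₁.1])), run_ret, PMF.prob_pure,
      if_neg (by simpa using hv.symm)]
    exact zero_le

/-- Markov's inequality in a form linear in the norms, so that it can be averaged over the random
flattening. A norm above `80 * τ` makes the right side at least 1. Otherwise correct estimates are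
at most `3/2 * 80 * τ = 120 * τ`, and only the two estimation failures remain. -/
theorem prob_flattenedTest_inaccurate_le (hE : NormEstimatesCorrect E) (hτ₁ : 0 < τ₁)
    (hτ₂ : 0 < τ₂) :
    ((flattenedTest E T b₁ b₂ τ₁ τ₂ ε).run fun _ => p).prob {Verdict.inaccurate}
      ≤ ENNReal.ofReal (1 / 60)
        + (ENNReal.ofReal (1 / (80 * τ₁))
            * ENNReal.ofReal (l2NormSq (flattenLaw b₁ (p.map Prod.fst)))
          + ENNReal.ofReal (1 / (80 * τ₂))
            * ENNReal.ofReal (l2NormSq (flattenLaw b₂ (p.map Prod.snd)))) := by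
  have hbig : ∀ x τ : ℝ, 0 < τ → 80 * τ < x →
      1 ≤ ENNReal.ofReal (1 / (80 * τ)) * ENNReal.ofReal x := fun x τ hτ hx => by
    rw [← ENNReal.ofReal_mul (by positivity), ENNReal.one_le_ofReal, div_mul_eq_mul_div, one_mul]
    exact (one_le_div (by positivity)).2 hx.le
  by_cases h1 : l2NormSq (flattenLaw b₁ (p.map Prod.fst)) ≤ 80 * τ₁
  swap
  · exact (PMF.prob_le_one _ _).trans ((hbig _ _ hτ₁ (not_le.1 h1)).trans
      (le_self_add.trans le_add_self))
  by_cases h2 : l2NormSq (flattenLaw b₂ (p.map Prod.snd)) ≤ 80 * τ₂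
  swap
  · exact (PMF.prob_le_one _ _).trans ((hbig _ _ hτ₂ (not_le.1 h2)).trans
      (le_add_self.trans le_add_self))
  refine le_trans ?_ le_self_add
  rw [flattenedTest_eq, run_bind]
  simp only [run_bind, run_simulate, run_flatSample₁, run_flatSample₂]
  have e : ENNReal.ofReal (1 / 60) = ENNReal.ofReal (1 / 120) + ENNReal.ofReal (1 / 120) := by
    rw [← ENNReal.ofReal_add (by norm_num) (by norm_num)]; norm_num
  rw [e]
  refine (PMF.prob_bind_le _ _ _ _ (ENNReal.ofReal (1 / 120)) fun L₁ hL₁ => ?_).trans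
    (add_le_add_left (hE _ _) _)
  rw [← add_zero (ENNReal.ofReal (1 / 120))]
  refine (PMF.prob_bind_le _ _ _ _ 0 fun L₂ hL₂ => ?_).trans (add_le_add_left (hE _ _) _)
  rw [Set.notMem_compl_iff, Set.mem_ofPred_eq] at hL₁ hL₂
  rw [if_neg (by push Not; constructor <;> linarith [hL₁.2, hL₂.2]), flattenedJointTest, run_bind,
    PMF.prob_bind]
  refine PMF.lexp_le_of_le _ fun L => ?_
  split_ifs
  · rw [run_ret, PMF.prob_pure, if_neg (by simp)]
  · rw [run_bind, PMF.prob_bind]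
    refine PMF.lexp_le_of_le _ fun c => ?_
    rw [run_ret, PMF.prob_pure, if_neg (by cases c <;> simp)]

theorem run_bif_flatSample (i : Bool) :
    (bif i then flatSampleProd b₁ b₂ else flatSampleJoint b₁ b₂).run (fun _ => p)
      = bif i then ((flattenLaw b₁ (p.map Prod.fst)).prodLaw
          (flattenLaw b₂ (p.map Prod.snd))).map finProdFinEquiv
        else (flattenLaw₂ b₁ b₂ p).map finProdFinEquiv := by
  cases i
  · exact run_flatSampleJoint b₁ b₂ p
  · exact run_flatSampleProd b₁ b₂ p

theorem l2NormSq_flattenProd_le (hτ₁ : 0 < τ₁)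
    (h1 : l2NormSq (flattenLaw b₁ (p.map Prod.fst)) ≤ 2 * 120 * τ₁)
    (h2 : l2NormSq (flattenLaw b₂ (p.map Prod.snd)) ≤ 2 * 120 * τ₂) :
    l2NormSq (((flattenLaw b₁ (p.map Prod.fst)).prodLaw
      (flattenLaw b₂ (p.map Prod.snd))).map finProdFinEquiv) ≤ 4 * 120 ^ 2 * τ₁ * τ₂ := by
  rw [l2NormSq_map_equiv, l2NormSq_prodLaw]
  refine (mul_le_mul h1 h2 (l2NormSq_nonneg _) (by positivity)).trans (le_of_eq (by ring))

/-- For a product, the flattened joint law is the flattened product, of squared norm at most `4 *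
120 ^ 2 * τ₁ * τ₂`. A correct estimate is at most `6 * 120 ^ 2 * τ₁ * τ₂`, below the cutoff, so only
failures of the subroutines cause rejection. -/
theorem prob_flattenedTest_reject_le (hE : NormEstimatesCorrect E)
    (hT : ClosenessTestsCorrect T) (hτ₁ : 0 < τ₁) (hτ₂ : 0 < τ₂) (hε : 0 < ε) (hε' : ε < 1)
    (hp : IsProductDist p) :
    ((flattenedTest E T b₁ b₂ τ₁ τ₂ ε).run fun _ => p).prob {Verdict.reject}
      ≤ ENNReal.ofReal (1 / 120) + (ENNReal.ofReal (1 / 120) + ENNReal.ofReal (1 / 80)) := by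
  refine prob_flattenedTest_le b₁ b₂ p hE (by simp) fun h1 h2 => ?_
  have hle := l2NormSq_flattenProd_le b₁ b₂ p hτ₁ h1 h2
  have heq : flattenLaw₂ b₁ b₂ p
      = (flattenLaw b₁ (p.map Prod.fst)).prodLaw (flattenLaw b₂ (p.map Prod.snd)) := by
    conv_lhs => rw [(isProductDist_iff p).1 hp]
    rw [flattenLaw₂_prodLaw]
  have hb : 0 < 4 * 120 ^ 2 * τ₁ * τ₂ := by positivity
  rw [flattenedJointTest, run_bind]
  simp only [run_simulate, run_flatSampleJoint]
  refine (PMF.prob_bind_le _ _ _ _ (ENNReal.ofReal (1 / 80)) fun L hL => ?_).trans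
    (add_le_add_left (hE _ _) _)
  rw [Set.notMem_compl_iff, Set.mem_ofPred_eq, heq] at hL
  rw [if_neg (by push Not; linarith [hL.2]), run_bind, run_simulate,
    ← add_zero (ENNReal.ofReal (1 / 80))]
  simp only [run_bif_flatSample]
  refine (PMF.prob_bind_le _ _ _ _ 0 fun c hc => ?_).trans (add_le_add_left
    ((hT _ _ ε hb hε hε' _ _ (min_le_iff.2 (Or.inr hle))).1 (by rw [heq])) 0)
  rw [Set.notMem_compl_iff, Set.mem_singleton_iff] at hc
  rw [run_ret, PMF.prob_pure, if_neg (by simp [hc])]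

/-- The check of the joint norm can only lead to rejection, so it is harmless here. The closeness
promise holds through the product, whatever the joint norm. -/
theorem prob_flattenedTest_accept_le (hE : NormEstimatesCorrect E)
    (hT : ClosenessTestsCorrect T) (hτ₁ : 0 < τ₁) (hτ₂ : 0 < τ₂) (hε : 0 < ε) (hε' : ε < 1)
    (hp : IsFarFromProduct ε p) :
    ((flattenedTest E T b₁ b₂ τ₁ τ₂ ε).run fun _ => p).prob {Verdict.accept}
      ≤ ENNReal.ofReal (1 / 120) + ENNReal.ofReal (1 / 80) := by
  refine prob_flattenedTest_le b₁ b₂ p hE (by simp) fun h1 h2 => ?_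
  have hle := l2NormSq_flattenProd_le b₁ b₂ p hτ₁ h1 h2
  have hfar : ε ≤ tvDist ((flattenLaw₂ b₁ b₂ p).map finProdFinEquiv)
      (((flattenLaw b₁ (p.map Prod.fst)).prodLaw
        (flattenLaw b₂ (p.map Prod.snd))).map finProdFinEquiv) := by
    rw [tvDist_map_equiv, ← flattenLaw₂_prodLaw, tvDist_flattenLaw₂]
    exact hp _ ⟨_, _, fun i j => PMF.prodLaw_apply _ _ i j⟩
  have hb : 0 < 4 * 120 ^ 2 * τ₁ * τ₂ := by positivity
  rw [flattenedJointTest, run_bind, PMF.prob_bind]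
  refine PMF.lexp_le_of_le _ fun L => ?_
  split_ifs
  · rw [run_ret, PMF.prob_pure, if_neg (by simp)]
    exact zero_le
  · rw [run_bind, run_simulate, ← add_zero (ENNReal.ofReal (1 / 80))]
    simp only [run_bif_flatSample]
    refine (PMF.prob_bind_le _ _ _ _ 0 fun c hc => ?_).trans (add_le_add_left
      ((hT _ _ ε hb hε hε' _ _ (min_le_iff.2 (Or.inr hle))).2 hfar) 0)
    rw [Set.notMem_compl_iff, Set.mem_singleton_iff] at hc
    rw [run_ret, PMF.prob_pure, if_neg (by simp [hc])]

end FlattenedTest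

/-! ### Correctness of the augmented independence tester -/

/-- The expected number of samples that refine the flattening of the first marginal. -/
def firstRate (n m : ℕ) (α ε : ℝ) : ℝ :=
  min ((n : ℝ) ^ (2 / 3 : ℝ) * (m : ℝ) ^ (1 / 3 : ℝ) * α ^ (1 / 3 : ℝ) * ε ^ (-4 / 3 : ℝ)) (n * α)

theorem firstRate_pos_or {n m : ℕ} {α ε : ℝ} (hn : 0 < n) (hm : 0 < m) (hε : 0 < ε) (hα : 0 ≤ α) :
    0 < firstRate n m α ε ∨ α = 0 ∧ firstRate n m α ε = 0 := by
  rcases hα.eq_or_lt with rfl | h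
  · exact Or.inr ⟨rfl, by rw [firstRate, Real.zero_rpow (by norm_num)]; simp⟩
  · exact Or.inl (lt_min (by positivity) (by positivity))

section Tester

variable (E : (N : ℕ) → (δ : ℝ) → SampleProg Unit (Fin N) ℝ)
  (T : (N : ℕ) → (b ε δ : ℝ) → SampleProg Bool (Fin N) Bool)
  (n m : ℕ) (α ε : ℝ) (phat : PMF (Fin n × Fin m))

/-- The tester after the numbers of samples for the flattening have been drawn. -/
def testerOfCounts (t₁ t₂ : ℕ) : SampleProg Unit (Fin n × Fin m) Verdict :=
  (samples () t₁).bind fun S₁ => (samples () t₂).bind fun S₂ =>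
    flattenedTest E T (buckets (phat.map Prod.fst) (S₁.map Prod.fst))
      (buckets (phat.map Prod.snd) (S₂.map Prod.snd))
      (2 * α / firstRate n m α ε + 4 / n) (2 * α / (m * α) + 4 / m) ε

theorem augIndependenceTester_eq : augIndependenceTester E T n m α ε phat =
    (random (poisson (firstRate n m α ε))).bind fun t₁ =>
    (random (poisson (m * α))).bind fun t₂ =>
    if (t₁ : ℝ) > 160 * firstRate n m α ε ∨ (t₂ : ℝ) > 160 * (m * α) then ret Verdict.reject
    else testerOfCounts E T n m α ε phat t₁ t₂ := rfl

variable {E T n m α ε}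

theorem prob_testerOfCounts_le (p : PMF (Fin n × Fin m)) (v : Verdict) {c : ℝ≥0∞}
    (hc : ∀ S₁ S₂ : List (Fin n × Fin m),
      ((flattenedTest E T (buckets (phat.map Prod.fst) (S₁.map Prod.fst))
        (buckets (phat.map Prod.snd) (S₂.map Prod.snd))
        (2 * α / firstRate n m α ε + 4 / n) (2 * α / (m * α) + 4 / m) ε).run fun _ => p).prob {v}
        ≤ c) (t₁ t₂ : ℕ) :
    ((testerOfCounts E T n m α ε phat t₁ t₂).run fun _ => p).prob {v} ≤ c := by
  rw [testerOfCounts, run_bind, PMF.prob_bind]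
  refine PMF.lexp_le_of_le _ fun S₁ => ?_
  rw [run_bind, PMF.prob_bind]
  exact PMF.lexp_le_of_le _ fun S₂ => hc S₁ S₂

theorem isAugIndependenceTester_augIndependenceTester (hE : NormEstimatesCorrect E)
    (hT : ClosenessTestsCorrect T)
    (hn : 0 < n) (hm : 0 < m) (hε : 0 < ε) (hε' : ε < 1) (hα : 0 ≤ α) :
    IsAugIndependenceTester α ε 0.1 (augIndependenceTester E T n m α ε) := by
  intro p phat
  have hs₁ := firstRate_pos_or hn hm hε hα
  have hs₁0 : 0 ≤ firstRate n m α ε := by rcases hs₁ with h | h; exacts [h.le, h.2.ge]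
  have hs₂ : 0 < m * α ∨ α = 0 ∧ m * α = 0 := by
    rcases hα.eq_or_lt with rfl | h
    · exact Or.inr ⟨rfl, mul_zero _⟩
    · exact Or.inl (by positivity)
  have hs₂0 : 0 ≤ m * α := by positivity
  have hτ₁ : 0 < 2 * α / firstRate n m α ε + 4 / n := by positivity
  have hτ₂ : 0 < 2 * α / (m * α) + 4 / m := by positivity
  have hfin : ∀ {c d : ℝ≥0∞} (x : ℝ), c ≤ d → d = ENNReal.ofReal x → 0 ≤ x → x ≤ 0.1 / 2 →
      c.toReal ≤ 0.1 / 2 := fun x h1 h2 h0 h3 =>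
    (ENNReal.toReal_le_of_le_ofReal h0 (h1.trans_eq h2)).trans h3
  rw [augIndependenceTester_eq]
  refine ⟨fun hp => ?_, fun hp => ?_, fun hp => ?_⟩
  · rw [← PMF.prob_singleton]
    -- Two Poisson overflows, one marginal estimate, the joint estimate and the closeness test:
    -- `1/24` in total, below `1/20`.
    refine hfin (d := ENNReal.ofReal (1 / 160) + (ENNReal.ofReal (1 / 160) +
      (ENNReal.ofReal (1 / 120) + (ENNReal.ofReal (1 / 120) + ENNReal.ofReal (1 / 80)))))
      (1 / 160 + (1 / 160 + (1 / 120 + (1 / 120 + 1 / 80)))) ?_ ?_ (by norm_num) (by norm_num)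
    · rw [run_bind, run_random]
      refine (PMF.prob_bind_le _ _ _ _ _ fun t₁ ht₁ => ?_).trans
        (add_le_add_left (prob_poisson_gt_le hs₁0) _)
      rw [run_bind, run_random]
      refine (PMF.prob_bind_le _ _ _ _ _ fun t₂ ht₂ => ?_).trans
        (add_le_add_left (prob_poisson_gt_le hs₂0) _)
      rw [Set.mem_ofPred_eq] at ht₁ ht₂
      rw [if_neg (not_or.2 ⟨ht₁, ht₂⟩)]
      exact prob_testerOfCounts_le phat p _ (fun S₁ S₂ =>
        prob_flattenedTest_reject_le _ _ p hE hT hτ₁ hτ₂ hε hε' hp) t₁ t₂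
    · rw [ENNReal.ofReal_add, ENNReal.ofReal_add, ENNReal.ofReal_add, ENNReal.ofReal_add] <;>
        norm_num
  · rw [← PMF.prob_singleton]
    refine hfin (d := ENNReal.ofReal (1 / 120) + ENNReal.ofReal (1 / 80)) (1 / 120 + 1 / 80) ?_ ?_
      (by norm_num) (by norm_num)
    · rw [run_bind, run_random, PMF.prob_bind]
      refine PMF.lexp_le_of_le _ fun t₁ => ?_
      rw [run_bind, run_random, PMF.prob_bind]
      refine PMF.lexp_le_of_le _ fun t₂ => ?_
      split_ifs
      · rw [run_ret, PMF.prob_pure, if_neg (by simp)]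
        exact zero_le
      · exact prob_testerOfCounts_le phat p _ (fun S₁ S₂ =>
          prob_flattenedTest_accept_le _ _ p hE hT hτ₁ hτ₂ hε hε' hp) t₁ t₂
    · rw [ENNReal.ofReal_add] <;> norm_num
  · rw [← PMF.prob_singleton]
    set τ₁ := 2 * α / firstRate n m α ε + 4 / n with hτ₁def
    set τ₂ := 2 * α / (m * α) + 4 / m with hτ₂def
    refine hfin (d := ENNReal.ofReal (1 / 60) + (ENNReal.ofReal (1 / (80 * τ₁)) * ENNReal.ofReal τ₁
      + ENNReal.ofReal (1 / (80 * τ₂)) * ENNReal.ofReal τ₂)) (1 / 60 + (1 / 80 + 1 / 80)) ?_ ?_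
      (by norm_num) (by norm_num)
    -- Overflowing counts lead to `reject`, so the bound may be averaged over the untruncated
    -- Poisson counts, as the expected-norm estimate requires.
    · calc _ ≤ (poisson (firstRate n m α ε)).lexp fun t₁ => (poisson (m * α)).lexp fun t₂ =>
            (p.iidList t₁).lexp fun S₁ => (p.iidList t₂).lexp fun S₂ =>
            ENNReal.ofReal (1 / 60)
            + (ENNReal.ofReal (1 / (80 * τ₁)) * ENNReal.ofReal (l2NormSq (flattenLaw
                (buckets (phat.map Prod.fst) (S₁.map Prod.fst)) (p.map Prod.fst)))
              + ENNReal.ofReal (1 / (80 * τ₂)) * ENNReal.ofReal (l2NormSq (flattenLaw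
                (buckets (phat.map Prod.snd) (S₂.map Prod.snd)) (p.map Prod.snd)))) := by
            rw [run_bind, run_random, PMF.prob_bind]
            refine PMF.lexp_mono _ fun t₁ => ?_
            rw [run_bind, run_random, PMF.prob_bind]
            refine PMF.lexp_mono _ fun t₂ => ?_
            split_ifs
            · rw [run_ret, PMF.prob_pure, if_neg (by simp)]
              exact zero_le
            · rw [testerOfCounts, run_bind, PMF.prob_bind, run_samples]
              refine PMF.lexp_mono _ fun S₁ => ?_
              rw [run_bind, PMF.prob_bind, run_samples]
              exact PMF.lexp_mono _ fun S₂ =>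
                prob_flattenedTest_inaccurate_le _ _ p hE hτ₁ hτ₂
        _ ≤ _ := by
            have h1 := lexp_l2NormSq_flattenLaw_le (p.map Prod.fst) (phat.map Prod.fst) hn hs₁
              ((tvDist_map_le _ _ _).trans hp)
            have h2 := lexp_l2NormSq_flattenLaw_le (p.map Prod.snd) (phat.map Prod.snd) hm hs₂
              ((tvDist_map_le _ _ _).trans hp)
            simp only [← PMF.lexp_iidList_map] at h1 h2
            simp only [PMF.lexp_add, PMF.lexp_const, PMF.lexp_const_mul]
            gcongr
    · have e : ∀ τ : ℝ, 0 < τ → ENNReal.ofReal (1 / (80 * τ)) * ENNReal.ofReal τ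
          = ENNReal.ofReal (1 / 80) := fun τ hτ => by
        rw [← ENNReal.ofReal_mul (by positivity)]
        congr 1
        field_simp
      rw [e _ hτ₁, e _ hτ₂, ENNReal.ofReal_add, ENNReal.ofReal_add] <;> norm_num

end Tester

end

open scoped ENNReal

noncomputable section

/-! ### Sample complexity -/

namespace SampleProg

variable {ι κ X Y R S : Type}

theorem bind_assoc {U : Type} (P : SampleProg ι X R) (f : R → SampleProg ι X S)
    (g : S → SampleProg ι X U) : (P.bind f).bind g = P.bind fun r => (f r).bind g := by
  induction P with
  | ret r => rfl
  | draw i k ih => simp only [bind, ih]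
  | toss q k ih => simp only [bind, ih]

theorem UsesAtMost.maxSamples_le {P : SampleProg ι X R} {a : ℝ} (h : P.UsesAtMost a) :
    P.maxSamples ≤ (⌊a⌋₊ : ℕ) := by
  obtain ⟨k, hk, hka⟩ := h
  exact hk.trans (by exact_mod_cast Nat.le_floor hka)

theorem UsesAtMost.mono {P : SampleProg ι X R} {a b : ℝ} (h : P.UsesAtMost a) (hab : a ≤ b) :
    P.UsesAtMost b := by
  obtain ⟨k, hk, hka⟩ := h
  exact ⟨k, hk, hka.trans hab⟩

theorem UsesAtMost.ret (r : R) {a : ℝ} (ha : 0 ≤ a) :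
    (SampleProg.ret r : SampleProg ι X R).UsesAtMost a :=
  ⟨0, maxSamples_ret_le _ _, by simpa using ha⟩

theorem UsesAtMost.bind {P : SampleProg ι X R} {f : R → SampleProg ι X S} {a b : ℝ}
    (hP : P.UsesAtMost a) (hb : 0 ≤ b) (hf : ∀ r, (f r).UsesAtMost b) :
    (P.bind f).UsesAtMost (a + b) := by
  obtain ⟨k, hk, hka⟩ := hP
  refine ⟨k + ⌊b⌋₊, ?_, ?_⟩
  · push_cast
    exact maxSamples_bind_le _ _ hk fun r => (hf r).maxSamples_le
  · push_cast
    exact add_le_add hka (Nat.floor_le hb)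

theorem UsesAtMost.random_bind (q : PMF R) {f : R → SampleProg ι X S} {b : ℝ} (hb : 0 ≤ b)
    (hf : ∀ r, (f r).UsesAtMost b) : ((random q).bind f).UsesAtMost b := by
  rw [← zero_add b]
  exact UsesAtMost.bind ⟨0, maxSamples_random_le _ _, by simp⟩ hb hf

theorem UsesAtMost.simulate {P : SampleProg κ Y R} {h : κ → SampleProg ι X Y} {a : ℝ} (d : ℕ)
    (hP : P.UsesAtMost a) (hd : ∀ i, (h i).maxSamples ≤ d) :
    (SampleProg.simulate h P).UsesAtMost (d * a) := by
  obtain ⟨k, hk, hka⟩ := hP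
  refine ⟨d * k, (maxSamples_simulate_le h P hd).trans ?_, ?_⟩
  · push_cast
    gcongr
  · push_cast
    gcongr

/-- The general bound for `bind` asks for a continuation bounded on all lists. Here the cost depends
on the number of buckets, controlled only for lists of length `k`. -/
theorem maxSamples_samples_bind_le (i : ι) (k : ℕ) (f : List X → SampleProg ι X R) {b : ℕ∞}
    (hf : ∀ l, l.length = k → (f l).maxSamples ≤ b) :
    ((samples i k).bind f).maxSamples ≤ k + b := by
  induction k generalizing f with
  | zero => simpa [samples, SampleProg.bind] using hf [] rfl
  | succ k ih =>
    have h : (samples i (k + 1)).bind f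
        = draw i fun x => (samples i k).bind fun l => f (x :: l) := by
      change SampleProg.draw i (fun x =>
        ((samples i k).bind fun l => SampleProg.ret (x :: l)).bind f) = _
      simp only [bind_assoc]
      rfl
    rw [h, maxSamples, Nat.cast_succ, add_right_comm]
    gcongr
    exact iSup_le fun x => ih _ fun l hl => hf _ (by simp [hl])

theorem UsesAtMost.samples_bind (i : ι) (k : ℕ) {f : List X → SampleProg ι X R} {b : ℝ}
    (hb : 0 ≤ b) (hf : ∀ l, l.length = k → (f l).UsesAtMost b) :
    ((samples i k).bind f).UsesAtMost (k + b) := by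
  refine ⟨k + ⌊b⌋₊, ?_, ?_⟩
  · push_cast
    exact maxSamples_samples_bind_le i k f fun l hl => (hf l hl).maxSamples_le
  · push_cast
    exact add_le_add le_rfl (Nat.floor_le hb)

end SampleProg

open SampleProg

/-- The floors add up to at most `n`, the extra buckets to `n`, and the frequencies to the number of
samples. -/
theorem sum_buckets_le {n : ℕ} (q : PMF (Fin n)) (l : List (Fin n)) :
    ((∑ i, buckets q l i : ℕ) : ℝ) ≤ 2 * n + l.length := by
  have h1 : ∑ i, l.count i = l.length := by
    simpa using Multiset.sum_count_eq_card (s := Finset.univ) (m := (l : Multiset (Fin n)))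
      fun a _ => Finset.mem_univ a
  have h2 : ∑ i, (⌊(n : ℝ) * (q i).toReal⌋₊ : ℝ) ≤ n := by
    calc ∑ i, (⌊(n : ℝ) * (q i).toReal⌋₊ : ℝ) ≤ ∑ i, (n : ℝ) * (q i).toReal :=
          Finset.sum_le_sum fun i _ => Nat.floor_le (by positivity)
      _ = n := by rw [← Finset.mul_sum, q.toReal_sum_eq_one, mul_one]
  have h3 : ((∑ i, l.count i : ℕ) : ℝ) = l.length := by rw [h1]
  push_cast at h3
  simp only [buckets]
  push_cast
  rw [Finset.sum_add_distrib, Finset.sum_add_distrib, h3]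
  simp
  linarith

/-- The leading term of the sample complexity for inaccurate predictions. -/
def flatteningCost (n m : ℕ) (α ε : ℝ) : ℝ :=
  (n : ℝ) ^ (2 / 3 : ℝ) * (m : ℝ) ^ (1 / 3 : ℝ) * α ^ (1 / 3 : ℝ) / ε ^ (4 / 3 : ℝ)

theorem flatteningCost_nonneg (n m : ℕ) {α ε : ℝ} (hα : 0 ≤ α) (hε : 0 < ε) :
    0 ≤ flatteningCost n m α ε := by
  unfold flatteningCost; positivity

theorem firstRate_eq (n m : ℕ) (α : ℝ) {ε : ℝ} (hε : 0 < ε) :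
    firstRate n m α ε = min (flatteningCost n m α ε) (n * α) := by
  rw [firstRate, flatteningCost, neg_div, Real.rpow_neg hε.le, ← div_eq_mul_inv]

/-- This removes all fractional exponents; later estimates use only this polynomial identity. -/
theorem flatteningCost_cube (n m : ℕ) {α ε : ℝ} (hα : 0 ≤ α) (hε : 0 < ε) :
    flatteningCost n m α ε ^ 3 * ε ^ 4 = n ^ 2 * m * α := by
  have h : ∀ (x : ℝ) (y : ℝ) (k : ℕ), 0 ≤ x → y * 3 = k → (x ^ y) ^ 3 = x ^ k :=
    fun x y k hx hy => by
      rw [← Real.rpow_natCast (x ^ y), ← Real.rpow_mul hx, ← Real.rpow_natCast x, ← hy]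
      norm_num
  rw [flatteningCost, div_pow, mul_pow, mul_pow, h _ _ 2 (by positivity) (by norm_num),
    h _ _ 1 (by positivity) (by norm_num), h _ _ 1 hα (by norm_num), h _ _ 4 hε.le (by norm_num)]
  field_simp

/-- The sample bound of the theorem, without the constant. -/
def sampleBound (n m : ℕ) (α ε : ℝ) : ℝ :=
  max (√((n : ℝ) * m) / ε ^ 2) (flatteningCost n m α ε)

/-! ### Thresholds and rates against the sample bound -/

section Bounds

variable {n m : ℕ} {α ε : ℝ}

theorem sqrt_le_sampleBound (hε : 0 < ε) (hε' : ε < 1) : √((n : ℝ) * m) ≤ sampleBound n m α ε := by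
  refine le_trans ?_ (le_max_left _ _)
  rw [le_div_iff₀ (by positivity)]
  exact mul_le_of_le_one_right (Real.sqrt_nonneg _) (by nlinarith)

/-- Either `s₁ = A`, and `n ^ 2 * m * α / A = A ^ 2 * ε ^ 4` by the cube identity, or `s₁ = n * α`,
and the term collapses to `2 * n * m`. -/
theorem firstThreshold_le (hn : 0 < n) (hm : 0 < m) (hε : 0 < ε) (hα : 0 ≤ α) :
    (n : ℝ) ^ 2 * m * (2 * α / firstRate n m α ε + 4 / n)
      ≤ 2 * (flatteningCost n m α ε ^ 2 * ε ^ 4) + 6 * (n * m) := by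
  have hn' : (0 : ℝ) < n := by exact_mod_cast hn
  have hm' : (0 : ℝ) < m := by exact_mod_cast hm
  have hA := flatteningCost_cube n m hα hε
  set A := flatteningCost n m α ε with hAdef
  have hA0 : 0 ≤ A := flatteningCost_nonneg n m hα hε
  have e1 : (n : ℝ) ^ 2 * m * (4 / n) = 4 * (n * m) := by field_simp
  rw [mul_add, e1, firstRate_eq n m α hε]
  rcases min_choice A (n * α) with h | h <;> rw [h]
  · have h1 : (n : ℝ) ^ 2 * m * (2 * α / A) ≤ 2 * (A ^ 2 * ε ^ 4) := by
      rcases hA0.eq_or_lt with h0 | h0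
      · rw [← h0]; simp
      · rw [← mul_div_assoc, div_le_iff₀ h0]
        nlinarith
    have : 0 ≤ (n : ℝ) * m := by positivity
    linarith
  · have h1 : (n : ℝ) ^ 2 * m * (2 * α / (n * α)) ≤ 2 * (n * m) := by
      rcases hα.eq_or_lt with h0 | h0
      · rw [← h0]; simp; positivity
      · exact le_of_eq (by field_simp)
    have : 0 ≤ A ^ 2 * ε ^ 4 := by positivity
    linarith

theorem secondThreshold_le (hα : 0 ≤ α) : m * (2 * α / (m * α) + 4 / m) ≤ 6 := by
  rcases Nat.eq_zero_or_pos m with h | h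
  · simp [h]
  have hm' : (0 : ℝ) < m := by exact_mod_cast h
  rcases hα.eq_or_lt with h0 | h0
  · rw [← h0, mul_zero, zero_div, zero_add, mul_div_cancel₀ _ hm'.ne']
    norm_num
  · exact le_of_eq (by field_simp; norm_num)

/-- Group `(n * m) ^ 2 * τ₁ * τ₂` as `(n ^ 2 * m * τ₁) * (m * τ₂)`. Both `A ^ 2 * ε ^ 4` and `n * m`
are at most `(M * ε ^ 2) ^ 2`, which gives the factor `(2 + 6) * 6 = 48 ≤ 7 ^ 2`. -/
theorem closenessCost_le (hn : 0 < n) (hm : 0 < m) (hε : 0 < ε) (hα : 0 ≤ α) :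
    (n : ℝ) * m * √((2 * α / firstRate n m α ε + 4 / n) * (2 * α / (m * α) + 4 / m)) / ε ^ 2
      ≤ 7 * sampleBound n m α ε := by
  have h1 := firstThreshold_le hn hm hε hα (n := n) (m := m)
  have h2 := secondThreshold_le hα (m := m)
  have hA0 := flatteningCost_nonneg n m hα hε
  have hs0 : 0 ≤ firstRate n m α ε := by
    rcases firstRate_pos_or hn hm hε hα with h | h; exacts [h.le, h.2.ge]
  set τ₁ := 2 * α / firstRate n m α ε + 4 / n with hτ₁
  set τ₂ := 2 * α / (m * α) + 4 / m with hτ₂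
  have hτ₁0 : 0 ≤ τ₁ := by positivity
  have hτ₂0 : 0 ≤ τ₂ := by positivity
  set A := flatteningCost n m α ε with hA
  set M := sampleBound n m α ε with hM
  have hAM : A ≤ M := le_max_right _ _
  have hM0 : 0 ≤ M := hA0.trans hAM
  have hnm : (n : ℝ) * m ≤ (M * ε ^ 2) ^ 2 := by
    rw [← Real.sqrt_le_left (by positivity), ← div_le_iff₀ (by positivity)]
    exact le_max_left _ _
  rw [div_le_iff₀ (by positivity)]
  have e : (n : ℝ) * m * √(τ₁ * τ₂) = √((n ^ 2 * m * τ₁) * (m * τ₂)) := by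
    rw [show (n : ℝ) ^ 2 * m * τ₁ * (m * τ₂) = (n * m) ^ 2 * (τ₁ * τ₂) by ring,
      Real.sqrt_mul (sq_nonneg _), Real.sqrt_sq (by positivity)]
  rw [e]
  refine Real.sqrt_le_iff.2 ⟨by positivity, ?_⟩
  have h3 : A ^ 2 * ε ^ 4 ≤ M ^ 2 * ε ^ 4 := by gcongr
  calc (n ^ 2 * m * τ₁) * (m * τ₂)
      ≤ (2 * (A ^ 2 * ε ^ 4) + 6 * (n * m)) * 6 := by
        refine mul_le_mul h1 h2 (by positivity) (by positivity)
    _ ≤ (7 * M * ε ^ 2) ^ 2 := by nlinarith [sq_nonneg (M * ε ^ 2)]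

end Bounds

section TesterCost

variable {E : (N : ℕ) → (δ : ℝ) → SampleProg Unit (Fin N) ℝ}
  {T : (N : ℕ) → (b ε δ : ℝ) → SampleProg Bool (Fin N) Bool} {CE CT : ℝ}

theorem usesAtMost_flattenedTest
    (hE : ∀ N : ℕ, (E N (1 / 120)).UsesAtMost (CE * √N))
    (hT : ∀ (N : ℕ) (b ε : ℝ), 0 < b → 0 < ε → ε < 1 →
      (T N b ε (1 / 80)).UsesAtMost (CT * (N * √b / ε ^ 2)))
    (hCE : 0 ≤ CE) (hCT : 0 ≤ CT)
    {n m : ℕ} (b₁ : Fin n → ℕ) (b₂ : Fin m → ℕ) [∀ i, NeZero (b₁ i)] [∀ j, NeZero (b₂ j)]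
    {τ₁ τ₂ ε M : ℝ} (hτ₁ : 0 < τ₁) (hτ₂ : 0 < τ₂) (hε : 0 < ε) (hε' : ε < 1)
    (hn : 0 < n) (hm : 0 < m)
    (hb₁ : ((∑ i, b₁ i : ℕ) : ℝ) ≤ 162 * n) (hb₂ : ((∑ j, b₂ j : ℕ) : ℝ) ≤ 162 * m)
    (hnm : √((n : ℝ) * m) ≤ M) (hτ : (n : ℝ) * m * √(τ₁ * τ₂) / ε ^ 2 ≤ 7 * M) :
    (flattenedTest E T b₁ b₂ τ₁ τ₂ ε).UsesAtMost
      ((3 * 162 * CE + 2 * 162 ^ 2 * 240 * 7 * CT) * M) := by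
  have hM : 0 ≤ M := (Real.sqrt_nonneg _).trans hnm
  have hn' : (1 : ℝ) ≤ n := by exact_mod_cast hn
  have hm' : (1 : ℝ) ≤ m := by exact_mod_cast hm
  have hs : ∀ x : ℝ, x ≤ 162 ^ 2 * (n * m) → CE * √x ≤ 162 * CE * M := fun x hx => by
    have h1 : √x ≤ 162 * √((n : ℝ) * m) := by
      refine (Real.sqrt_le_sqrt hx).trans (le_of_eq ?_)
      rw [Real.sqrt_mul (by norm_num), Real.sqrt_sq (by norm_num)]
    calc CE * √x ≤ CE * (162 * M) := by gcongr; linarith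
      _ = 162 * CE * M := by ring
  have hE₁ : CE * √((∑ i, b₁ i : ℕ) : ℝ) ≤ 162 * CE * M := hs _ (hb₁.trans (by nlinarith))
  have hE₂ : CE * √((∑ j, b₂ j : ℕ) : ℝ) ≤ 162 * CE * M := hs _ (hb₂.trans (by nlinarith))
  have hB : (((∑ i, b₁ i) * ∑ j, b₂ j : ℕ) : ℝ) ≤ 162 ^ 2 * (n * m) := by
    rw [Nat.cast_mul]
    exact (mul_le_mul hb₁ hb₂ (by positivity) (by positivity)).trans (le_of_eq (by ring))
  have hE₃ := hs _ hB
  have hT' : CT * ((((∑ i, b₁ i) * ∑ j, b₂ j : ℕ) : ℝ) * √(4 * 120 ^ 2 * τ₁ * τ₂) / ε ^ 2)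
      ≤ 162 ^ 2 * 240 * 7 * CT * M := by
    have e : √(4 * 120 ^ 2 * τ₁ * τ₂) = 240 * √(τ₁ * τ₂) := by
      rw [show 4 * 120 ^ 2 * τ₁ * τ₂ = 240 ^ 2 * (τ₁ * τ₂) by ring, Real.sqrt_mul (by norm_num),
        Real.sqrt_sq (by norm_num)]
    rw [e]
    calc CT * ((((∑ i, b₁ i) * ∑ j, b₂ j : ℕ) : ℝ) * (240 * √(τ₁ * τ₂)) / ε ^ 2)
        ≤ CT * (162 ^ 2 * (n * m) * (240 * √(τ₁ * τ₂)) / ε ^ 2) := by gcongr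
      _ = CT * (162 ^ 2 * 240) * (n * m * √(τ₁ * τ₂) / ε ^ 2) := by ring
      _ ≤ CT * (162 ^ 2 * 240) * (7 * M) := by gcongr
      _ = 162 ^ 2 * 240 * 7 * CT * M := by ring
  have hb : 0 < 4 * 120 ^ 2 * τ₁ * τ₂ := by positivity
  have hEM : 0 ≤ 162 * CE * M := by positivity
  have hTM : 0 ≤ 162 ^ 2 * 240 * 7 * CT * M := by positivity
  rw [flattenedTest_eq]
  -- Three norm estimates at one sample per query, then the closeness test at up to two, since a
  -- sample of the product uses two samples of `p`.
  refine UsesAtMost.mono (a := ((1 : ℕ) * (162 * CE * M)) + (((1 : ℕ) * (162 * CE * M)) +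
    (((1 : ℕ) * (162 * CE * M)) + (((2 : ℕ) * (162 ^ 2 * 240 * 7 * CT * M)) + 0)))) ?_
    (le_of_eq (by push_cast; ring))
  refine UsesAtMost.bind (UsesAtMost.simulate 1 ((hE _).mono hE₁)
    fun _ => by simpa using maxSamples_flatSample₁_le b₁) (by positivity) fun L₁ => ?_
  refine UsesAtMost.bind (UsesAtMost.simulate 1 ((hE _).mono hE₂)
    fun _ => by simpa using maxSamples_flatSample₂_le b₂) (by positivity) fun L₂ => ?_
  split_ifs
  · exact UsesAtMost.ret _ (by positivity)
  refine UsesAtMost.bind (UsesAtMost.simulate 1 ((hE _).mono hE₃)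
    fun _ => by simpa using maxSamples_flatSampleJoint_le b₁ b₂) (by positivity) fun L => ?_
  split_ifs
  · exact UsesAtMost.ret _ (by positivity)
  refine UsesAtMost.bind (UsesAtMost.simulate 2 ((hT _ _ _ hb hε hε').mono hT') fun i => ?_)
    le_rfl fun c => UsesAtMost.ret _ le_rfl
  cases i
  · exact (maxSamples_flatSampleJoint_le b₁ b₂).trans (by norm_num)
  · simpa using maxSamples_flatSampleProd_le b₁ b₂

theorem usesAtMost_augIndependenceTester
    (hE : ∀ N : ℕ, (E N (1 / 120)).UsesAtMost (CE * √N))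
    (hT : ∀ (N : ℕ) (b ε : ℝ), 0 < b → 0 < ε → ε < 1 →
      (T N b ε (1 / 80)).UsesAtMost (CT * (N * √b / ε ^ 2)))
    (hCE : 0 ≤ CE) (hCT : 0 ≤ CT) {n m : ℕ} {α ε : ℝ} (hm : 0 < m) (hmn : m ≤ n)
    (hε : 0 < ε) (hε' : ε < 1) (hα : 0 ≤ α) (hα' : α ≤ 1) (phat : PMF (Fin n × Fin m)) :
    (augIndependenceTester E T n m α ε phat).UsesAtMost
      ((320 + (3 * 162 * CE + 2 * 162 ^ 2 * 240 * 7 * CT)) * sampleBound n m α ε) := by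
  have hn : 0 < n := hm.trans_le hmn
  have hn' : (0 : ℝ) < n := by exact_mod_cast hn
  have hm' : (0 : ℝ) < m := by exact_mod_cast hm
  have hmn' : (m : ℝ) ≤ n := by exact_mod_cast hmn
  have hs0 : 0 ≤ firstRate n m α ε := by
    rcases firstRate_pos_or hn hm hε hα with h | h; exacts [h.le, h.2.ge]
  have hτ := closenessCost_le hn hm hε hα
  have hnm := sqrt_le_sampleBound (n := n) (m := m) (α := α) hε hε'
  have hs₁ : firstRate n m α ε ≤ sampleBound n m α ε := by
    rw [firstRate_eq n m α hε]
    exact (min_le_left _ _).trans (le_max_right _ _)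
  have hs₁' : firstRate n m α ε ≤ n := by
    rw [firstRate_eq n m α hε]
    exact (min_le_right _ _).trans (mul_le_of_le_one_right hn'.le hα')
  have hs₂' : m * α ≤ m := mul_le_of_le_one_right hm'.le hα'
  -- This is where `m ≤ n` enters: it gives `m ≤ √(n * m)`.
  have hs₂ : m * α ≤ sampleBound n m α ε := by
    refine hs₂'.trans (le_trans ?_ hnm)
    exact Real.le_sqrt_of_sq_le (by nlinarith)
  set M := sampleBound n m α ε with hMdef
  have hM : 0 ≤ M := (Real.sqrt_nonneg _).trans hnm
  have hC : 0 ≤ (3 * 162 * CE + 2 * 162 ^ 2 * 240 * 7 * CT) * M := by positivity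
  rw [augIndependenceTester_eq]
  refine UsesAtMost.random_bind _ (by positivity) fun t₁ =>
    UsesAtMost.random_bind _ (by positivity) fun t₂ => ?_
  split_ifs with ht
  · exact UsesAtMost.ret _ (by positivity)
  push Not at ht
  -- Past the overflow check the counts add at most `160 * s₁ + 160 * s₂ ≤ 320 * M`. They also keep
  -- the bucket totals below `(2 + 160) * n` and `(2 + 160) * m`, as `s₁ ≤ n` and `s₂ ≤ m`.
  refine UsesAtMost.mono (a := t₁ + (t₂ + (3 * 162 * CE + 2 * 162 ^ 2 * 240 * 7 * CT) * M)) ?_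
    (by linarith [ht.1, ht.2])
  refine UsesAtMost.samples_bind _ _ (by positivity) fun S₁ hS₁ =>
    UsesAtMost.samples_bind _ _ hC fun S₂ hS₂ => ?_
  refine usesAtMost_flattenedTest hE hT hCE hCT _ _ (by positivity) (by positivity) hε hε' hn hm
    ((sum_buckets_le _ _).trans ?_) ((sum_buckets_le _ _).trans ?_) hnm hτ
  · rw [List.length_map, hS₁]
    linarith [ht.1]
  · rw [List.length_map, hS₂]
    linarith [ht.2]

end TesterCost

end

theorem theorem2 :
    (∃ E : (N : ℕ) → (δ : ℝ) → SampleProg Unit (Fin N) ℝ, IsL2NormEstimator E) ∧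
    (∃ T : (N : ℕ) → (b ε δ : ℝ) → SampleProg Bool (Fin N) Bool, IsClosenessTester T) ∧
    ∀ (E : (N : ℕ) → (δ : ℝ) → SampleProg Unit (Fin N) ℝ)
      (T : (N : ℕ) → (b ε δ : ℝ) → SampleProg Bool (Fin N) Bool),
      IsL2NormEstimator E → IsClosenessTester T →
      ∃ C : ℝ, 0 < C ∧ ∀ (n m : ℕ) (ε α : ℝ), 2 ≤ m → m ≤ n → 0 < ε → ε < 1 → 0 ≤ α → α ≤ 1 →
        IsAugIndependenceTester α ε 0.1 (augIndependenceTester E T n m α ε) ∧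
        ∀ phat : PMF (Fin n × Fin m),
          (augIndependenceTester E T n m α ε phat).UsesAtMost
            (C * max (√((n : ℝ) * m) / ε ^ 2)
              ((n : ℝ) ^ (2 / 3 : ℝ) * (m : ℝ) ^ (1 / 3 : ℝ) * α ^ (1 / 3 : ℝ)
                / ε ^ (4 / 3 : ℝ))) := by
  refine ⟨⟨_, isL2NormEstimator_normEstimator⟩, ⟨_, isClosenessTester_closenessTester⟩, ?_⟩
  rintro E T ⟨CE, hCE, hE⟩ ⟨CT, hCT, hT⟩
  have hlogE : 0 ≤ Real.log (1 / (1 / 120)) := Real.log_nonneg (by norm_num)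
  have hlogT : 0 ≤ Real.log (1 / (1 / 80)) := Real.log_nonneg (by norm_num)
  refine ⟨320 + (3 * 162 * (CE * Real.log (1 / (1 / 120)))
    + 2 * 162 ^ 2 * 240 * 7 * (CT * Real.log (1 / (1 / 80)))), by positivity,
    fun n m ε α hm hmn hε hε' hα hα' => ⟨?_, fun phat => ?_⟩⟩
  · refine isAugIndependenceTester_augIndependenceTester (fun N p => ?_)
      (fun N b ε hb hε hε' p q hpq => ⟨fun h => ?_, fun h => ?_⟩) (by omega) (by omega) hε hε' hα
    · exact PMF.prob_compl_le_of_one_sub_le ((hE N (1 / 120) (by norm_num) (by norm_num)).2 p)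
    · refine PMF.prob_compl_le_of_one_sub_le ?_
      rw [PMF.toOuterMeasure_apply_singleton]
      exact ((hT N b ε (1 / 80) hb hε hε' (by norm_num) (by norm_num)).2 p q hpq).1 h
    · refine PMF.prob_compl_le_of_one_sub_le ?_
      rw [PMF.toOuterMeasure_apply_singleton]
      exact ((hT N b ε (1 / 80) hb hε hε' (by norm_num) (by norm_num)).2 p q hpq).2 h
  · refine usesAtMost_augIndependenceTester (fun N => ?_) (fun N b ε hb hε hε' => ?_)
      (by positivity) (by positivity) (by omega) hmn hε hε' hα hα' phat
    · exact (hE N (1 / 120) (by norm_num) (by norm_num)).1.mono (le_of_eq (by ring))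
    · exact (hT N b ε (1 / 80) hb hε hε' (by norm_num) (by norm_num)).1.mono
        (le_of_eq (by ring))
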